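/- Let $J\ge 0$ be an integer and let $\mathfrak b=(\mathfrak b_1,\dots,\mathfrak b_J)\in\mathbb R^J$ satisfy $\sum_{j=1}^J\mathfrak b_j=J$ and $\sum_{i\in I}\mathfrak b_i\neq 0$ for every nonempty $I\subset\{1,\dots,J\}$. For $Z=(z_1,\dots,z_J)\in\mathbb C^J$ and $|z|>\max_j|z_j|$, expand each factor by the binomial theorem and write $$\prod_{j=1}^J (z-z_j)^{\mathfrak b_j}=z^J\prod_{j=1}^J\Bigl(1-\frac{z_j}{z}\Bigr)^{\mathfrak b_j}=\sum_{k=0}^\infty d_k(Z)\,z^{J-k}.$$ Define $\mathcal F=\mathcal F_{\mathfrak b}:\mathbb C^J\to\mathbb C^J$ by $\mathcal F(Z)=A=(A_1,\dots,A_J)$, $A_\ell=d_\ell(Z)$. Let $\Delta=\{Z: z_i=z_j\text{ for some }i\ne j\}$ be the union of the partial diagonals and let $\mathcal S_{\mathfrak b}=\mathcal F(\Delta)$ be the weighted discriminant locus. Then $\mathcal S_{\mathfrak b}$ is a proper algebraic subvariety of $\mathbb C^J$ (possibly empty), $\mathcal F$ is a proper holomorphic map, and: (i) $\mathcal F$ is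 ramified exactly along $\Delta$, i.e. the set of points at which $\mathcal F$ is not a local biholomorphism equals $\Delta$; the image of this set is $\mathcal S_{\mathfrak b}$. (ii) $\mathcal F^{-1}(\mathbb C^J\setminus\mathcal S_{\mathfrak b})$ consists of $J$-tuples of pairwise distinct points, and $\mathcal F:\mathcal F^{-1}(\mathbb C^J\setminus\mathcal S_{\mathfrak b})\to\mathbb C^J\setminus\mathcal S_{\mathfrak b}$ is a $J!$-sheeted covering map. (iii) Let $0\in\Omega\subset\mathbb C^J$ and let $A\mapsto(z_1(A),\dots,z_J(A))$ be any right inverse of $\mathcal F$ on $\Omega$, i.e. $\mathcal F(z_1(A),\dots,z_J(A))=A$ for $A\in\Omega$ (for instance on a neighbourhood of $0$, or a local branch of $\mathcal F^{-1}$ on a set with $0$ in its closure, extended by $0\mapsto 0$). Then for every $z=|z|e^{i\theta}\ne 0$ the function $$v(A;z)=\sum_{j=1}^J\mathfrak b_j\log|z-z_j(A)|$$ is (real) differentiable at $A=0$ relative to $\Omega$, and, writing $A_\ell=e'_\ell+i\,e''_\ell$, it has a differential there with components $$\frac{\partial v}{\partial e'_\ell}(0)=\cos(\ell\theta)\,|z|^{-\ell},\qquad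 \frac{\partial v}{\partial e''_\ell}(0)=\sin(\ell\theta)\,|z|^{-\ell},\qquad \ell=1,\dots,J.$$ In particular, if $\Omega$ is a neighbourhood of $0$, then $v(\cdot\,;z)$ is differentiable at $0$ in the usual sense with these partial derivatives. -/

import Mathlib

noncomputable section

namespace WeightedCluster

variable {J : ℕ}

/-- The degenerate weights: those for which the weights of some nonempty subcluster sum to zero. -/
def degenerateWeights (J : ℕ) : Set (Fin J → ℝ) :=
  ⋃ I : {I : Finset (Fin J) // I.Nonempty}, {b | ∑ i ∈ I.1, b i = 0}

/-- The series `∏ i (1 - z_i w) ^ (b i)` in the variable `w = 1 / z`, where each factor is expanded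
by the binomial theorem. When the weights sum to `J`, this is
`z ^ (-J) * ∏ i (z - z_i) ^ (b i) = ∑ k, d_k z ^ (-k)`. -/
def expansion (b : Fin J → ℝ) (Z : Fin J → ℂ) : PowerSeries ℂ :=
  ∏ i, PowerSeries.rescale (-Z i) (PowerSeries.binomialSeries ℂ (b i))

/-- The map `(z_1, …, z_J) ↦ (A_1, …, A_J) = (d_1, …, d_J)`; the index `ℓ : Fin J` stands for the
integer `ℓ + 1`. -/
def coeffMap (b : Fin J → ℝ) (Z : Fin J → ℂ) : Fin J → ℂ :=
  fun ℓ => PowerSeries.coeff ((ℓ : ℕ) + 1) (expansion b Z)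

/-- The union of the partial diagonals. -/
def partialDiagonals (J : ℕ) : Set (Fin J → ℂ) :=
  {Z | ∃ i j, i ≠ j ∧ Z i = Z j}

/-- The weighted discriminant locus. -/
def discriminantLocus (b : Fin J → ℝ) : Set (Fin J → ℂ) :=
  coeffMap b '' partialDiagonals J

/-- `F` restricts to a biholomorphism from an open neighbourhood of `Z` onto an open set. -/
def IsLocalBiholomorphAt (F : (Fin J → ℂ) → (Fin J → ℂ)) (Z : Fin J → ℂ) : Prop :=
  ∃ e : OpenPartialHomeomorph (Fin J → ℂ) (Fin J → ℂ),
    Z ∈ e.source ∧ Set.EqOn F e e.source ∧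
      DifferentiableOn ℂ e e.source ∧ DifferentiableOn ℂ e.symm e.target

/-- The points at which `F` is ramified, that is, not a local biholomorphism. -/
def ramificationLocus (F : (Fin J → ℂ) → (Fin J → ℂ)) : Set (Fin J → ℂ) :=
  {Z | ¬ IsLocalBiholomorphAt F Z}

/-- The function `∑ j, b_j log |z - z_j|`. -/
def logPotential (b : Fin J → ℝ) (Z : Fin J → ℂ) (z : ℂ) : ℝ :=
  ∑ j, b j * Real.log ‖z - Z j‖

end WeightedCluster

end

/-! ### Weighted power sums and their common zeros -/

noncomputable section

namespace WeightedCluster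

/-! Logarithmic differentiation of `∏ (1 - z_i w) ^ b_i` gives Newton's identities between the
coefficients `d_k` and the weighted power sums `p_k = ∑ b_i z_i ^ k`. They are triangular, so
`coeffMap` is `powerSumMap` followed by the polynomial automorphism `newtonMap`, and most questions
reduce to power sums.

Nondegeneracy of the weights enters through one fact: `p_1 = ⋯ = p_J = 0` forces `Z = 0`
(`eq_zero_of_powerSum_eq_zero`). Over the residue field of a valuation ring it makes the coordinates
integral over the components of the map, so the image of the Vandermonde locus is algebraic by
lying-over. On the unit sphere, with homogeneity and compactness, it gives the lower bound
`exists_lt_norm_powerSumMap`, hence properness. The Jacobian of the power sums is a Vandermonde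
matrix with rescaled rows and columns, so ramification occurs exactly on the diagonals; off the
discriminant a proper local homeomorphism is a covering.

The sheet number comes from deforming the weights to `(1, …, 1)`, where fibres are the orderings of
the roots of a polynomial. The deformation runs along a complex line: for a generic target only
countably many parameters are bad, and their complement in `ℂ` is connected (`ncard_powerSumMap`).

For (iii), expanding the logarithms gives `v = ∑ b_j log|z| - Re ∑ p_ℓ / (ℓ z ^ ℓ) + O(|Z| ^
(J+1))`. Here `p_ℓ = -ℓ A_ℓ + O(|A|²)`, while the lower bound yields `|Z| ^ J = O(|A|)`, so the
error is `o(|A|)`. -/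

/-- The weights of every nonempty subcluster have nonzero sum. -/
def NondegenerateWeights {J : ℕ} {R : Type*} [CommRing R] (b : Fin J → R) : Prop :=
  ∀ I : Finset (Fin J), I.Nonempty → ∑ i ∈ I, b i ≠ 0

/-- The weighted power sums `∑ i, b i * Z i ^ (k + 1)`. -/
def powerSum {J : ℕ} {R : Type*} [CommRing R] (b Z : Fin J → R) (k : ℕ) : R :=
  ∑ i, b i * Z i ^ (k + 1)

theorem NondegenerateWeights.map {J : ℕ} {R S : Type*} [CommRing R] [CommRing S] {b : Fin J → R}
    (hb : NondegenerateWeights b) (f : R →+* S) (hf : Function.Injective f) :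
    NondegenerateWeights (fun i => f (b i)) := by
  intro I hI h
  rw [← map_sum, map_eq_zero_iff f hf] at h
  exact hb I hI h

theorem NondegenerateWeights.ne_zero {J : ℕ} {R : Type*} [CommRing R] {b : Fin J → R}
    (hb : NondegenerateWeights b) (i : Fin J) : b i ≠ 0 := by
  simpa using hb {i} (Finset.singleton_nonempty i)

theorem nondegenerateWeights_of_notMem {J : ℕ} {b : Fin J → ℝ} (hb : b ∉ degenerateWeights J) :
    NondegenerateWeights b := by
  intro I hI h
  exact hb (Set.mem_iUnion.2 ⟨⟨I, hI⟩, h⟩)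

theorem map_powerSum {J : ℕ} {R S : Type*} [CommRing R] [CommRing S] (f : R →+* S)
    (b Z : Fin J → R) (k : ℕ) :
    f (powerSum b Z k) = powerSum (fun i => f (b i)) (fun i => f (Z i)) k := by
  simp [powerSum]

-- If some value `v ≠ 0` is taken, test the relations against the polynomial `q` vanishing at the
-- other values. Its degree is below `J`, and what survives is `v * q(v)` times the total weight of
-- the subcluster at `v`, which is nonzero.
open Polynomial in
theorem eq_zero_of_powerSum_eq_zero {J : ℕ} {R : Type*} [CommRing R] [IsDomain R]
    {b Z : Fin J → R} (hb : NondegenerateWeights b) (h : ∀ k < J, powerSum b Z k = 0) : Z = 0 := by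
  classical
  by_contra hZ
  obtain ⟨i₀, hi₀⟩ := Function.ne_iff.1 hZ
  set v := Z i₀ with hv
  let s := (Finset.univ.image Z).erase v
  let q : R[X] := ∏ u ∈ s, (X - C u)
  have hdeg : q.natDegree < J := by
    rw [natDegree_prod_of_monic _ _ fun u _ => monic_X_sub_C u]
    simp only [natDegree_X_sub_C, Finset.sum_const, smul_eq_mul, mul_one]
    calc s.card < (Finset.univ.image Z).card :=
          Finset.card_erase_lt_of_mem (Finset.mem_image_of_mem Z (Finset.mem_univ i₀))
      _ ≤ _ := Finset.card_image_le
      _ = J := by simp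
  have hq : ∀ i, q.eval (Z i) = if Z i = v then q.eval v else 0 := by
    intro i
    split_ifs with hi
    · rw [hi]
    · rw [eval_prod]
      refine Finset.prod_eq_zero (i := Z i) ?_ (by simp)
      exact Finset.mem_erase.2 ⟨hi, Finset.mem_image_of_mem Z (Finset.mem_univ i)⟩
  have hqv : q.eval v ≠ 0 := by
    rw [eval_prod, Finset.prod_ne_zero_iff]
    intro u hu
    simpa [sub_eq_zero] using (Finset.ne_of_mem_erase hu).symm
  have hsum : ∑ i, b i * Z i * q.eval (Z i) = 0 := by
    simp_rw [eval_eq_sum_range, Finset.mul_sum]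
    rw [Finset.sum_comm]
    refine Finset.sum_eq_zero fun k hk => ?_
    have := h k ((Finset.mem_range_succ_iff.1 hk).trans_lt hdeg)
    rw [powerSum] at this
    calc _ = q.coeff k * ∑ i, b i * Z i ^ (k + 1) := by
          rw [Finset.mul_sum]; exact Finset.sum_congr rfl fun i _ => by ring
      _ = 0 := by rw [this, mul_zero]
  have hsum' : (∑ i with Z i = v, b i) * (v * q.eval v) = 0 := by
    rw [← hsum, Finset.sum_filter, Finset.sum_mul]
    refine Finset.sum_congr rfl fun i _ => ?_
    rw [hq i]
    split_ifs with hi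
    · rw [hi]; ring
    · simp
  rcases mul_eq_zero.1 hsum' with h | h
  · exact hb _ ⟨i₀, by simp [hv]⟩ h
  · exact (mul_ne_zero hi₀ hqv) h

/-- Extension by zero of a finite sequence. -/
def extendZero {J : ℕ} {R : Type*} [CommRing R] (a : Fin J → R) (k : ℕ) : R := if h : k < J then a ⟨k, h⟩ else 0

@[simp]
theorem extendZero_val {J : ℕ} {R : Type*} [CommRing R] (a : Fin J → R) (k : Fin J) : extendZero a k = a k := by
  simp [extendZero]

theorem extendZero_of_lt {J : ℕ} {R : Type*} [CommRing R] (a : Fin J → R) {k : ℕ} (h : k < J) :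
    extendZero a k = a ⟨k, h⟩ := by
  simp [extendZero, h]

/-! ### Newton's identities as a polynomial automorphism -/

section Newton

variable {R S : Type*} [CommRing R] [Algebra ℂ R] [CommRing S] [Algebra ℂ S]

/-- The coefficients of `exp (-∑ k, p k * X ^ (k + 1) / (k + 1))`. -/
def newtonCoeff (p : ℕ → R) : ℕ → R
  | 0 => 1
  | n + 1 => -((n + 1 : ℂ)⁻¹ • ∑ j : Fin (n + 1), p j * newtonCoeff p (n - j))

/-- The sequence `p` whose `newtonCoeff` is `1, d 0, d 1, …`. -/
def newtonSum (d : ℕ → R) (n : ℕ) : R :=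
  -((n + 1 : ℂ) • d n) - ∑ j : Fin n, newtonSum d j * d (n - 1 - j)
termination_by n
decreasing_by exact j.2

/-- Newton's identity between coefficients `d` and power sums `p` in degree `n + 1`. -/
def NewtonIdentity (p d : ℕ → R) (n : ℕ) : Prop :=
  (n + 1 : ℂ) • d (n + 1) = -∑ j : Fin (n + 1), p j * d (n - j)

theorem newtonIdentity_newtonCoeff (p : ℕ → R) (n : ℕ) : NewtonIdentity p (newtonCoeff p) n := by
  have : (n + 1 : ℂ) ≠ 0 := by exact_mod_cast n.succ_ne_zero
  rw [NewtonIdentity, newtonCoeff, smul_neg, smul_inv_smul₀ this]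

/-- The recursion is triangular, so agreement below `N` suffices; the zeros inserted by `extendZero`
beyond the first `J` terms do no harm. -/
theorem newtonCoeff_eq {N : ℕ} {p q d : ℕ → R} (h0 : d 0 = 1) (hpq : ∀ n < N, p n = q n)
    (h : ∀ n < N, NewtonIdentity p d n) : ∀ n ≤ N, newtonCoeff q n = d n := by
  intro n
  induction n using Nat.strong_induction_on with
  | _ n ih =>
    intro hn
    cases n with
    | zero => rw [newtonCoeff, h0]
    | succ n =>
      have hne : (n + 1 : ℂ) ≠ 0 := by exact_mod_cast n.succ_ne_zero
      rw [newtonCoeff, neg_eq_iff_eq_neg, inv_smul_eq_iff₀ hne, smul_neg, h n hn, neg_neg]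
      refine Finset.sum_congr rfl fun j _ => ?_
      rw [ih (n - j) (by omega) (by omega), hpq j (by omega)]

theorem newtonSum_eq {N : ℕ} {p d e : ℕ → R} (h0 : d 0 = 1) (hde : ∀ n < N, d (n + 1) = e n)
    (h : ∀ n < N, NewtonIdentity p d n) : ∀ n < N, newtonSum e n = p n := by
  intro n
  induction n using Nat.strong_induction_on with
  | _ n ih =>
    intro hn
    have := h n hn
    rw [NewtonIdentity, Fin.sum_univ_castSucc] at this
    simp only [Fin.val_castSucc, Fin.val_last, tsub_self, h0, mul_one] at this
    rw [newtonSum, ← hde n hn, this, neg_neg]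
    have : ∑ j : Fin n, newtonSum e j * e (n - 1 - j) = ∑ j : Fin n, p j * d (n - j) := by
      refine Finset.sum_congr rfl fun j _ => ?_
      rw [ih j j.2 (by omega), ← hde _ (by omega)]
      congr 2
      omega
    rw [this]
    ring

theorem newtonIdentity_newtonSum (e : ℕ → R) (n : ℕ) :
    NewtonIdentity (newtonSum e) (fun k => k.casesOn 1 e) n := by
  rw [NewtonIdentity, Fin.sum_univ_castSucc]
  simp only [Fin.val_castSucc, Fin.val_last, tsub_self]
  rw [newtonSum]
  have : ∑ j : Fin n, newtonSum e j * e (n - 1 - j) =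
      ∑ j : Fin n, newtonSum e j * (n - (j : ℕ)).casesOn 1 e := by
    refine Finset.sum_congr rfl fun j _ => ?_
    obtain ⟨m, hm⟩ : ∃ m, n - (j : ℕ) = m + 1 := ⟨n - j - 1, by omega⟩
    rw [hm, show n - 1 - (j : ℕ) = m by omega]
  rw [this]
  change _ = -(_ + _ * (1 : R))
  rw [mul_one, add_sub_cancel, neg_neg]

theorem map_newtonCoeff (f : R →ₐ[ℂ] S) (p : ℕ → R) (n : ℕ) :
    f (newtonCoeff p n) = newtonCoeff (fun k => f (p k)) n := by
  induction n using Nat.strong_induction_on with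
  | _ n ih =>
    cases n with
    | zero => simp [newtonCoeff]
    | succ n =>
      rw [newtonCoeff, newtonCoeff, map_neg, map_smul, map_sum]
      congr 2
      refine Finset.sum_congr rfl fun j _ => ?_
      rw [map_mul, ih (n - j) (by omega)]

/-- The passage from power sums to coefficients. -/
def newtonMap {J : ℕ} (a : Fin J → R) (ℓ : Fin J) : R := newtonCoeff (extendZero a) (ℓ + 1)

/-- The passage from coefficients to power sums. -/
def newtonInv {J : ℕ} (A : Fin J → R) (ℓ : Fin J) : R := newtonSum (extendZero A) ℓ

theorem newtonMap_newtonInv {J : ℕ} (A : Fin J → R) : newtonMap (newtonInv A) = A := by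
  funext ℓ
  rw [newtonMap, newtonCoeff_eq (N := J) (d := fun k => k.casesOn 1 (extendZero A)) rfl ?_
    (fun n _ => newtonIdentity_newtonSum (extendZero A) n) _ ℓ.2]
  · simp
  · intro n hn
    rw [extendZero_of_lt _ hn, newtonInv]

theorem newtonInv_newtonMap {J : ℕ} (a : Fin J → R) : newtonInv (newtonMap a) = a := by
  funext ℓ
  rw [newtonInv, newtonSum_eq (N := J) (d := newtonCoeff (extendZero a)) (by simp [newtonCoeff]) ?_
    (fun n _ => newtonIdentity_newtonCoeff (extendZero a) n) _ ℓ.2]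
  · simp
  · intro n hn
    rw [extendZero_of_lt _ hn, newtonMap]

end Newton

/-! ### The logarithmic derivative of the binomial product -/

section Expansion

open PowerSeries

theorem derivative_binomialSeries (r : ℝ) :
    (1 + X : PowerSeries ℂ) * d⁄dX ℂ (PowerSeries.binomialSeries ℂ r) = (r : ℂ) • PowerSeries.binomialSeries ℂ r := by
  ext n
  have key : ∀ n : ℕ, Ring.choose r (n + 1) * (n + 1) = (r - n) * Ring.choose r n := by
    intro n
    have h1 := Ring.descPochhammer_eq_factorial_smul_choose r n
    have h2 := Ring.descPochhammer_eq_factorial_smul_choose r (n + 1)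
    rw [descPochhammer_succ_right, Polynomial.smeval_mul, h1] at h2
    simp only [Polynomial.smeval_sub, Polynomial.smeval_X, Polynomial.smeval_natCast, pow_one, pow_zero,
      nsmul_eq_mul, mul_one, Nat.factorial_succ] at h2
    push_cast at h2
    have hf : (n.factorial : ℝ) ≠ 0 := by exact_mod_cast n.factorial_ne_zero
    refine mul_left_cancel₀ hf ?_
    linear_combination -h2
  have key' : ∀ n : ℕ, (Ring.choose r (n + 1) : ℂ) * (n + 1) = (r - n) * (Ring.choose r n : ℂ) := by
    intro n
    exact_mod_cast congrArg (fun x : ℝ => (x : ℂ)) (key n)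
  cases n with
  | zero =>
    have h0 : coeff 0 ((1 + X : PowerSeries ℂ) * d⁄dX ℂ (PowerSeries.binomialSeries ℂ r)) =
        coeff 0 (d⁄dX ℂ (PowerSeries.binomialSeries ℂ r)) := by
      simp [add_mul]
    rw [h0, coeff_derivative, map_smul, binomialSeries_coeff, binomialSeries_coeff]
    simp
  | succ n =>
    simp only [add_mul, one_mul, map_add, coeff_succ_X_mul, coeff_derivative,
      binomialSeries_coeff, map_smul, smul_eq_mul, Complex.real_smul, mul_one]
    have := key' (n + 1)
    push_cast at this ⊢
    linear_combination this

theorem derivative_rescale (a : ℂ) (f : PowerSeries ℂ) :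
    d⁄dX ℂ (rescale a f) = a • rescale a (d⁄dX ℂ f) := by
  ext n
  simp only [coeff_derivative, coeff_rescale, map_smul, smul_eq_mul]
  ring

/-- The series `∑ k, z ^ (k + 1) X ^ k`. -/
def geomSeries (z : ℂ) : PowerSeries ℂ := PowerSeries.mk fun k => z ^ (k + 1)

theorem one_sub_mul_geomSeries (z : ℂ) : (1 - z • X) * geomSeries z = PowerSeries.C z := by
  ext n
  cases n with
  | zero => simp [sub_mul, geomSeries]
  | succ n =>
    simp only [sub_mul, one_mul, smul_mul_assoc, map_sub, map_smul, coeff_succ_X_mul, geomSeries,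
      coeff_mk, smul_eq_mul, coeff_C]
    simp
    ring

/-- The differential equation `(1 + X) f' = r f` is rescaled, and the nonzero factor `1 - z X` is
cancelled in the domain of power series. -/
theorem derivative_factor (r : ℝ) (z : ℂ) :
    d⁄dX ℂ (rescale (-z) (PowerSeries.binomialSeries ℂ r)) =
      -((r : ℂ) • geomSeries z) * rescale (-z) (PowerSeries.binomialSeries ℂ r) := by
  have h := congrArg (rescale (-z)) (derivative_binomialSeries r)
  rw [map_mul, map_add, map_one, rescale_X] at h
  have hX : (1 : PowerSeries ℂ) + C (-z) * X = 1 - z • X := by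
    rw [smul_eq_C_mul, map_neg]; ring
  have hne : (1 : PowerSeries ℂ) - z • X ≠ 0 := by
    intro h0
    simpa using congrArg (coeff 0) h0
  refine mul_left_cancel₀ hne ?_
  rw [derivative_rescale, mul_smul_comm, ← hX, h, hX]
  have hs : rescale (-z) ((r : ℂ) • PowerSeries.binomialSeries ℂ r) =
      (r : ℂ) • rescale (-z) (PowerSeries.binomialSeries ℂ r) := by
    ext n; simp [coeff_rescale]; ring
  rw [hs, neg_mul, mul_neg, smul_mul_assoc, mul_smul_comm, ← mul_assoc, one_sub_mul_geomSeries,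
    ← smul_eq_C_mul, neg_smul, smul_comm]

theorem derivative_expansion {J : ℕ} (b : Fin J → ℝ) (Z : Fin J → ℂ) :
    d⁄dX ℂ (expansion b Z) = -(∑ i, (b i : ℂ) • geomSeries (Z i)) * expansion b Z := by
  classical
  rw [expansion]
  induction (Finset.univ : Finset (Fin J)) using Finset.induction_on with
  | empty => simp
  | insert i s hi ih =>
    rw [Finset.prod_insert hi, Finset.sum_insert hi, Derivation.leibniz, ih, derivative_factor]
    simp only [smul_eq_mul]
    ring

theorem coeff_zero_expansion {J : ℕ} (b : Fin J → ℝ) (Z : Fin J → ℂ) :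
    coeff 0 (expansion b Z) = 1 := by
  rw [coeff_zero_eq_constantCoeff_apply, expansion, map_prod]
  refine Finset.prod_eq_one fun i _ => ?_
  rw [← coeff_zero_eq_constantCoeff_apply, coeff_rescale]
  simp

theorem newtonIdentity_expansion {J : ℕ} (b : Fin J → ℝ) (Z : Fin J → ℂ) (n : ℕ) :
    NewtonIdentity (powerSum (fun i => (b i : ℂ)) Z) (fun k => coeff k (expansion b Z)) n := by
  have h := congrArg (coeff n) (derivative_expansion b Z)
  rw [coeff_derivative, neg_mul, map_neg, coeff_mul,
    Finset.Nat.sum_antidiagonal_eq_sum_range_succ_mk] at h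
  rw [NewtonIdentity, smul_eq_mul, mul_comm, h, ← Fin.sum_univ_eq_sum_range (fun k =>
    coeff k (∑ i, (b i : ℂ) • geomSeries (Z i)) * coeff (n - k) (expansion b Z))]
  simp [powerSum, geomSeries]

/-- The weighted power sums of degrees `1, …, J`. -/
def powerSumMap {J : ℕ} {R : Type*} [CommRing R] (b Z : Fin J → R) (k : Fin J) : R :=
  powerSum b Z k

theorem coeffMap_eq_newtonMap {J : ℕ} (b : Fin J → ℝ) (Z : Fin J → ℂ) :
    coeffMap b Z = newtonMap (powerSumMap (fun i => (b i : ℂ)) Z) := by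
  funext ℓ
  rw [newtonMap, newtonCoeff_eq (N := J) (d := fun k => coeff k (expansion b Z))
    (coeff_zero_expansion b Z) ?_ (fun n _ => newtonIdentity_expansion b Z n) _ ℓ.2, coeffMap]
  intro n hn
  rw [extendZero_of_lt _ hn, powerSumMap]

theorem newtonInv_coeffMap {J : ℕ} (b : Fin J → ℝ) (Z : Fin J → ℂ) :
    newtonInv (coeffMap b Z) = powerSumMap (fun i => (b i : ℂ)) Z := by
  rw [coeffMap_eq_newtonMap, newtonInv_newtonMap]

theorem coeffMap_eq_iff {J : ℕ} (b : Fin J → ℝ) (Z A : Fin J → ℂ) :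
    coeffMap b Z = A ↔ powerSumMap (fun i => (b i : ℂ)) Z = newtonInv A := by
  rw [← newtonInv_coeffMap]
  constructor
  · rintro rfl; rfl
  · intro h
    rw [← newtonMap_newtonInv (coeffMap b Z), h, newtonMap_newtonInv]

end Expansion

end WeightedCluster

end

/-! ### Integrality and algebraicity of the discriminant locus -/

noncomputable section

namespace WeightedCluster

theorem newtonSum_mem {K : Type*} [Field K] [Algebra ℂ K] (V : Subring K)
    (hV : ∀ c : ℂ, algebraMap ℂ K c ∈ V) (d : ℕ → K) (hd : ∀ n, d n ∈ V) (n : ℕ) :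
    newtonSum d n ∈ V := by
  induction n using Nat.strong_induction_on with
  | _ n ih =>
    rw [newtonSum, Algebra.smul_def]
    exact V.sub_mem (V.neg_mem (V.mul_mem (hV _) (hd _)))
      (V.sum_mem fun j _ => V.mul_mem (ih j j.2) (hd _))

/-- A valuation ring containing the scalars and the weighted power sums contains the variables. -/
theorem mem_valuationSubring_of_powerSum_mem {J : ℕ} {K : Type*} [Field K] [Algebra ℂ K]
    (V : ValuationSubring K) (hV : ∀ c : ℂ, algebraMap ℂ K c ∈ V) {b : Fin J → ℂ}
    (hb : NondegenerateWeights b) (Z : Fin J → K)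
    (h : ∀ k < J, powerSum (fun i => algebraMap ℂ K (b i)) Z k ∈ V) (i : Fin J) : Z i ∈ V := by
  by_contra hi
  obtain ⟨m, -, hm⟩ := Finset.exists_max_image Finset.univ (fun j => V.valuation (Z j))
    ⟨i, Finset.mem_univ i⟩
  have hm1 : 1 < V.valuation (Z m) := by
    refine lt_of_lt_of_le ?_ (hm i (Finset.mem_univ i))
    rwa [← not_le, V.valuation_le_one_iff]
  have hm0 : Z m ≠ 0 := by
    intro h0
    rw [h0, map_zero] at hm1
    exact not_lt_zero hm1
  have hvm0 : V.valuation (Z m) ≠ 0 := (V.valuation.ne_zero_iff).2 hm0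
  have hmem : ∀ j, Z j / Z m ∈ V := by
    intro j
    rw [← V.valuation_le_one_iff, map_div₀]
    exact div_le_one_of_le₀ (hm j (Finset.mem_univ j)) zero_le
  let U : Fin J → V := fun j => ⟨Z j / Z m, hmem j⟩
  let c : ℂ →+* V := (algebraMap ℂ K).codRestrict V.toSubring hV
  let r := IsLocalRing.residue V
  -- Division by the coordinate of largest valuation, which exceeds 1, sends every power sum into
  -- the maximal ideal. All residues therefore vanish, although that of `U m` is 1.
  have hzero : (fun j => r (U j)) = 0 := by
    refine eq_zero_of_powerSum_eq_zero (hb.map (r.comp c) (r.comp c).injective) fun k hk => ?_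
    have : powerSum (fun i => r.comp c (b i)) (fun j => r (U j)) k =
        r (powerSum (fun i => c (b i)) U k) := by
      rw [map_powerSum]; rfl
    rw [this, IsLocalRing.residue_eq_zero_iff, V.valuation_lt_one_iff]
    have hval : ((powerSum (fun i => c (b i)) U k : V) : K) =
        powerSum (fun i => algebraMap ℂ K (b i)) Z k / Z m ^ (k + 1) := by
      have := map_powerSum V.subtype (fun i => c (b i)) U k
      refine this.trans ?_
      simp only [powerSum, Finset.sum_div]
      refine Finset.sum_congr rfl fun j _ => ?_
      change algebraMap ℂ K (b j) * (Z j / Z m) ^ (k + 1) = _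
      rw [div_pow, mul_div_assoc]
    rw [hval, map_div₀, map_pow, div_lt_one₀ (pow_pos (zero_lt_iff.2 hvm0) _)]
    exact lt_of_le_of_lt ((V.valuation_le_one_iff _).2 (h k hk)) (one_lt_pow₀ hm1 k.succ_ne_zero)
  have h1 : r (U m) = 1 := by
    have : U m = 1 := Subtype.ext (div_self hm0)
    rw [this, map_one]
  rw [congrFun hzero m] at h1
  exact zero_ne_one h1

open MvPolynomial

/-- The polynomials giving the components of `coeffMap`. -/
def coeffPoly {J : ℕ} (b : Fin J → ℝ) : Fin J → MvPolynomial (Fin J) ℂ :=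
  newtonMap (powerSumMap (fun i => C (b i : ℂ)) X)

theorem map_newtonMap {J : ℕ} {R S : Type*} [CommRing R] [Algebra ℂ R] [CommRing S] [Algebra ℂ S]
    (f : R →ₐ[ℂ] S) (a : Fin J → R) (ℓ : Fin J) :
    f (newtonMap a ℓ) = newtonMap (fun i => f (a i)) ℓ := by
  rw [newtonMap, newtonMap, map_newtonCoeff]
  congr 1
  funext k
  simp only [extendZero]
  split_ifs <;> simp

theorem aeval_coeffPoly {J : ℕ} (b : Fin J → ℝ) (Z : Fin J → ℂ) (ℓ : Fin J) :
    aeval Z (coeffPoly b ℓ) = coeffMap b Z ℓ := by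
  rw [coeffPoly, map_newtonMap, coeffMap_eq_newtonMap]
  congr 1
  funext k
  simp [powerSumMap, powerSum]

theorem aeval_aeval_coeffPoly {J : ℕ} (b : Fin J → ℝ) (Z : Fin J → ℂ)
    (p : MvPolynomial (Fin J) ℂ) :
    aeval Z (aeval (coeffPoly b) p) = aeval (coeffMap b Z) p := by
  have : (aeval Z).comp (aeval (coeffPoly b)) = aeval (R := ℂ) (coeffMap b Z) := by
    ext ℓ
    rw [AlgHom.comp_apply, aeval_X, aeval_X, aeval_coeffPoly]
  exact DFunLike.congr_fun this p

/-- The integral closure of a subring of a field is the intersection of the valuation rings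
containing it. Such a ring contains the components of the map, hence the power sums by `newtonInv`,
hence the variables. -/
theorem isIntegral_aeval_coeffPoly {J : ℕ} {b : Fin J → ℝ} (hb : NondegenerateWeights b) :
    (aeval (R := ℂ) (coeffPoly b)).toRingHom.IsIntegral := by
  set φ := aeval (R := ℂ) (coeffPoly b) with hφ
  let K := FractionRing (MvPolynomial (Fin J) ℂ)
  let ι : MvPolynomial (Fin J) ℂ →ₐ[ℂ] K := Algebra.algHom ℂ _ K
  have hι : Function.Injective ι := IsFractionRing.injective (MvPolynomial (Fin J) ℂ) K
  have hX : ∀ i, φ.toRingHom.IsIntegralElem (X i) := by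
    intro i
    let s : Subring K := (ι.comp φ).toRingHom.range
    have hmem : ι (X i) ∈ (integralClosure (Subring.closure (s : Set K)) K).toSubring := by
      rw [← iInf_valuationSubring_superset, Subring.mem_iInf]
      rintro ⟨V, hV⟩
      have hc : ∀ c : ℂ, algebraMap ℂ K c ∈ V := fun c =>
        hV ⟨C c, by simp⟩
      refine mem_valuationSubring_of_powerSum_mem V hc
        (hb.map Complex.ofRealHom Complex.ofReal_injective) (fun j => ι (X j)) ?_ i
      intro k hk
      have h1 : powerSum (fun i => algebraMap ℂ K (b i)) (fun j => ι (X j)) k =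
          newtonInv (newtonMap (powerSumMap (fun i => algebraMap ℂ K (b i)) fun j => ι (X j)))
            ⟨k, hk⟩ := by
        rw [newtonInv_newtonMap]; rfl
      change powerSum (fun i => algebraMap ℂ K (b i)) (fun j => ι (X j)) k ∈ V.toSubring
      rw [h1]
      refine newtonSum_mem V.toSubring hc _ ?_ _
      intro n
      simp only [extendZero]
      split_ifs with hn
      · have h2 : newtonMap (powerSumMap (fun i => algebraMap ℂ K (b i)) fun j => ι (X j)) ⟨n, hn⟩ =
            ι (φ (X ⟨n, hn⟩)) := by
          rw [hφ, aeval_X, coeffPoly, map_newtonMap]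
          congr 1
          funext k
          change powerSum _ _ _ = ι.toRingHom (powerSum _ _ _)
          rw [map_powerSum]
          congr 1
        rw [h2]
        exact hV ⟨X ⟨n, hn⟩, rfl⟩
      · exact V.toSubring.zero_mem
    rw [Subring.closure_eq] at hmem
    obtain ⟨p, hp, hp0⟩ : IsIntegral s (ι (X i)) := hmem
    -- The monic equation has coefficients in the image of `ι ∘ φ`; it is lifted to a monic one over
    -- the source, and `ι` is cancelled by injectivity.
    obtain ⟨q, hq, -, hqm⟩ := Polynomial.lifts_and_natDegree_eq_and_monic (p := p)
      (f := (ι.comp φ).toRingHom.rangeRestrict)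
      ((Polynomial.mem_lifts p).2
        (Polynomial.map_surjective _ (ι.comp φ).toRingHom.rangeRestrict_surjective p)) hp
    refine ⟨q, hqm, hι ?_⟩
    rw [map_zero, ← hp0, ← hq, Polynomial.eval₂_map]
    exact Polynomial.hom_eval₂ q φ.toRingHom ι.toRingHom (X i)
  intro p
  induction p using MvPolynomial.induction_on with
  | C c =>
    have : φ.toRingHom (C c) = C c := φ.commutes c
    rw [← this]
    exact φ.toRingHom.isIntegralElem_map
  | add p q hp hq => exact hp.add _ hq
  | mul_X p i hp => exact hp.mul _ (hX i)

/-- The union of the partial diagonals is the zero locus of a Vandermonde determinant. -/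
theorem mem_partialDiagonals_iff {J : ℕ} (Z : Fin J → ℂ) :
    Z ∈ partialDiagonals J ↔
      aeval Z (Matrix.vandermonde (X : Fin J → MvPolynomial (Fin J) ℂ)).det = 0 := by
  have : aeval Z (Matrix.vandermonde (X : Fin J → MvPolynomial (Fin J) ℂ)).det =
      (Matrix.vandermonde Z).det := by
    rw [AlgHom.map_det]
    congr 1
    ext i j
    simp [Matrix.vandermonde_apply]
  rw [this, Matrix.det_vandermonde_eq_zero_iff]
  constructor
  · rintro ⟨i, j, h, h'⟩; exact ⟨i, j, h', h⟩
  · rintro ⟨i, j, h, h'⟩; exact ⟨i, j, h', h⟩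

theorem _root_.RingHom.IsIntegral.exists_isMaximal_comap_eq {R S : Type*} [CommRing R] [CommRing S]
    {φ : R →+* S} (hφ : φ.IsIntegral) (I : Ideal S) (P : Ideal R) [hP : P.IsMaximal]
    (h : I.comap φ ≤ P) : ∃ Q ≥ I, Q.IsMaximal ∧ Q.comap φ = P := by
  algebraize [φ]
  obtain ⟨Q, hQI, hQ, hQP⟩ := Ideal.exists_ideal_over_prime_of_isIntegral P I h
  refine ⟨Q, hQI, ?_, hQP⟩
  refine Ideal.isMaximal_of_isIntegral_of_isMaximal_comap (R := R) Q ?_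
  rw [hQP]
  exact hP

theorem _root_.RingHom.IsIntegral.comap_ne_bot {R S : Type*} [CommRing R] [CommRing S] [Nontrivial R]
    [IsDomain S] {φ : R →+* S} (hφ : φ.IsIntegral) {I : Ideal S} {x : S} (hx : x ≠ 0)
    (hxI : x ∈ I) : I.comap φ ≠ ⊥ := by
  algebraize [φ]
  exact Ideal.comap_ne_bot_of_integral_mem hx hxI (hφ x)

/-- The ideal is the contraction of the one generated by the Vandermonde determinant `D`.
Integrality makes it nonzero, since `D ≠ 0`, and lets each maximal ideal above it lift to one
containing `D`, which is a point of a diagonal by the Nullstellensatz. -/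
theorem exists_ideal_discriminantLocus_eq {J : ℕ} {b : Fin J → ℝ}
    (hb : NondegenerateWeights b) :
    ∃ I : Ideal (MvPolynomial (Fin J) ℂ), I ≠ ⊥ ∧ discriminantLocus b = zeroLocus ℂ I := by
  set φ := aeval (R := ℂ) (coeffPoly b)
  set D := (Matrix.vandermonde (X : Fin J → MvPolynomial (Fin J) ℂ)).det
  have hD : D ≠ 0 := by
    rw [Matrix.det_vandermonde_ne_zero_iff]
    exact X_injective
  refine ⟨(Ideal.span {D}).comap φ.toRingHom, ?_, ?_⟩
  · exact (isIntegral_aeval_coeffPoly hb).comap_ne_bot hD (Ideal.mem_span_singleton_self D)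
  · ext A
    constructor
    · rintro ⟨Z, hZ, rfl⟩ p hp
      rw [← aeval_aeval_coeffPoly]
      obtain ⟨q, hq⟩ := Ideal.mem_span_singleton'.1 (Ideal.mem_comap.1 hp)
      change q * D = aeval (coeffPoly b) p at hq
      rw [← hq, map_mul, (mem_partialDiagonals_iff Z).1 hZ, mul_zero]
    · intro hA
      obtain ⟨Q, hQD, hQ, hQA⟩ := (isIntegral_aeval_coeffPoly hb).exists_isMaximal_comap_eq
        (Ideal.span {D}) (vanishingIdeal ℂ {A}) fun p hp => by
          rw [mem_vanishingIdeal_singleton_iff]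
          exact hA p hp
      obtain ⟨Z, hZ⟩ := isMaximal_iff_eq_vanishingIdeal_singleton.1 hQ
      refine ⟨Z, ?_, ?_⟩
      · rw [mem_partialDiagonals_iff, ← mem_vanishingIdeal_singleton_iff, ← hZ]
        exact hQD (Ideal.mem_span_singleton_self D)
      · funext ℓ
        have h1 : (X ℓ - C (A ℓ) : MvPolynomial (Fin J) ℂ) ∈ vanishingIdeal ℂ {A} := by
          rw [mem_vanishingIdeal_singleton_iff]; simp
        rw [← hQA, hZ] at h1
        have h2 : aeval Z (aeval (coeffPoly b) (X ℓ - C (A ℓ))) = 0 :=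
          (mem_vanishingIdeal_singleton_iff _ _).1 (Ideal.mem_comap.1 h1)
        rw [aeval_aeval_coeffPoly] at h2
        simpa [sub_eq_zero] using h2

end WeightedCluster

end

noncomputable section

namespace WeightedCluster

open Filter Topology

/-! ### Derivatives and the ramification locus -/

section Calculus

variable {E : Type*} [NormedAddCommGroup E] [NormedSpace ℂ E] {m : WithTop ℕ∞}

theorem contDiff_newtonCoeff {p : E → ℕ → ℂ} (hp : ∀ k, ContDiff ℂ m fun x => p x k) (n : ℕ) :
    ContDiff ℂ m fun x => newtonCoeff (p x) n := by
  induction n using Nat.strong_induction_on with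
  | _ n ih =>
    cases n with
    | zero => simpa only [newtonCoeff] using contDiff_const
    | succ n =>
      simp only [newtonCoeff]
      refine (ContDiff.const_smul (n + 1 : ℂ)⁻¹ ?_).neg
      exact ContDiff.sum fun j _ => (hp j).mul (ih (n - j) (by omega))

theorem contDiff_newtonSum {d : E → ℕ → ℂ} (hd : ∀ k, ContDiff ℂ m fun x => d x k) (n : ℕ) :
    ContDiff ℂ m fun x => newtonSum (d x) n := by
  induction n using Nat.strong_induction_on with
  | _ n ih =>
    have : (fun x => newtonSum (d x) n) = fun x =>
        -((n + 1 : ℂ) • d x n) - ∑ j : Fin n, newtonSum (d x) j * d x (n - 1 - j) := by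
      funext x
      rw [newtonSum]
    rw [this]
    exact (ContDiff.const_smul _ (hd n)).neg.sub
      (ContDiff.sum fun j _ => (ih j j.2).mul (hd _))

theorem contDiff_extendZero {J : ℕ} (k : ℕ) :
    ContDiff ℂ m fun a : Fin J → ℂ => extendZero a k := by
  unfold extendZero
  split_ifs with h
  · exact contDiff_apply ℂ ℂ (⟨k, h⟩ : Fin J)
  · exact contDiff_const

theorem contDiff_newtonMap {J : ℕ} : ContDiff ℂ m (newtonMap : (Fin J → ℂ) → Fin J → ℂ) :=
  contDiff_pi' fun _ => contDiff_newtonCoeff contDiff_extendZero _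

theorem contDiff_newtonInv {J : ℕ} : ContDiff ℂ m (newtonInv : (Fin J → ℂ) → Fin J → ℂ) :=
  contDiff_pi' fun _ => contDiff_newtonSum contDiff_extendZero _

theorem contDiff_powerSumMap {J : ℕ} :
    ContDiff ℂ m fun q : (Fin J → ℂ) × (Fin J → ℂ) => powerSumMap q.1 q.2 := by
  refine contDiff_pi' fun k => ?_
  simp only [powerSumMap, powerSum]
  fun_prop

theorem contDiff_coeffMap {J : ℕ} (b : Fin J → ℝ) : ContDiff ℂ m (coeffMap b) := by
  have : coeffMap b = newtonMap ∘ fun Z => powerSumMap (fun i => (b i : ℂ)) Z := by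
    funext Z
    exact coeffMap_eq_newtonMap b Z
  rw [this]
  exact contDiff_newtonMap.comp (contDiff_powerSumMap.comp (contDiff_const.prodMk contDiff_id))

theorem exists_hasFDerivAt_powerSumMap {J : ℕ} (b Z : Fin J → ℂ) :
    ∃ D : (Fin J → ℂ) × (Fin J → ℂ) →L[ℂ] (Fin J → ℂ),
      HasFDerivAt (fun q : (Fin J → ℂ) × (Fin J → ℂ) => powerSumMap q.1 q.2) D (b, Z) ∧
      ∀ h k ℓ, D (h, k) ℓ =
        ∑ i, (b i * ((ℓ + 1) * Z i ^ (ℓ : ℕ) * k i) + Z i ^ ((ℓ : ℕ) + 1) * h i) := by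
  let p₁ (i : Fin J) : (Fin J → ℂ) × (Fin J → ℂ) →L[ℂ] ℂ :=
    (ContinuousLinearMap.proj i).comp (ContinuousLinearMap.fst ℂ _ _)
  let p₂ (i : Fin J) : (Fin J → ℂ) × (Fin J → ℂ) →L[ℂ] ℂ :=
    (ContinuousLinearMap.proj i).comp (ContinuousLinearMap.snd ℂ _ _)
  refine ⟨ContinuousLinearMap.pi fun ℓ => ∑ i,
    (b i • (((ℓ + 1 : ℕ) * Z i ^ (ℓ : ℕ) : ℂ) • p₂ i) + Z i ^ ((ℓ : ℕ) + 1) • p₁ i), ?_, ?_⟩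
  · rw [hasFDerivAt_pi]
    intro ℓ
    change HasFDerivAt (fun q : (Fin J → ℂ) × (Fin J → ℂ) => ∑ i, q.1 i * q.2 i ^ ((ℓ : ℕ) + 1))
      (∑ i, (b i • (((ℓ + 1 : ℕ) * Z i ^ (ℓ : ℕ) : ℂ) • p₂ i) + Z i ^ ((ℓ : ℕ) + 1) • p₁ i)) (b, Z)
    refine HasFDerivAt.fun_sum fun i _ => ?_
    have h1 : HasFDerivAt (fun q : (Fin J → ℂ) × (Fin J → ℂ) => q.1 i) (p₁ i) (b, Z) :=
      (p₁ i).hasFDerivAt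
    have h2 : HasFDerivAt (fun q : (Fin J → ℂ) × (Fin J → ℂ) => q.2 i) (p₂ i) (b, Z) :=
      (p₂ i).hasFDerivAt
    convert! h1.mul (h2.pow ((ℓ : ℕ) + 1)) using 2
    simp
  · intro h k ℓ
    simp [p₁, p₂, mul_assoc]

theorem eq_zero_of_sum_mul_pow_eq_zero {J : ℕ} {b Z k : Fin J → ℂ} (hb : ∀ i, b i ≠ 0)
    (hZ : Function.Injective Z)
    (h : ∀ ℓ : Fin J, ∑ i, b i * ((ℓ + 1) * Z i ^ (ℓ : ℕ) * k i) = 0) : k = 0 := by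
  have := Matrix.eq_zero_of_forall_pow_sum_mul_pow_eq_zero (v := fun i => b i * k i) hZ fun ℓ => by
    have hne : ((ℓ : ℂ) + 1) ≠ 0 := by exact_mod_cast (ℓ : ℕ).succ_ne_zero
    refine mul_left_cancel₀ hne ?_
    rw [mul_zero, ← h ℓ, Finset.mul_sum]
    exact Finset.sum_congr rfl fun i _ => by ring
  funext i
  exact (mul_eq_zero.1 (congrFun this i)).resolve_left (hb i)

theorem exists_equiv_hasFDerivAt_of_injective {𝕜 : Type*} [RCLike 𝕜] {E : Type*}
    [NormedAddCommGroup E] [NormedSpace 𝕜 E] [FiniteDimensional 𝕜 E] {f : E → E} {x : E}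
    (hf : DifferentiableAt 𝕜 f x) (hinj : Function.Injective (fderiv 𝕜 f x)) :
    ∃ f' : E ≃L[𝕜] E, HasFDerivAt f (f' : E →L[𝕜] E) x := by
  have := FiniteDimensional.complete 𝕜 E
  refine ⟨(LinearEquiv.ofInjectiveEndo (fderiv 𝕜 f x : E →ₗ[𝕜] E)
    hinj).toContinuousLinearEquiv, ?_⟩
  convert hf.hasFDerivAt
  ext v
  rfl

theorem exists_openPartialHomeomorph_of_injective {𝕜 : Type*} [RCLike 𝕜] {E : Type*}
    [NormedAddCommGroup E] [NormedSpace 𝕜 E] [FiniteDimensional 𝕜 E] {f : E → E} {x : E}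
    (hf : ContDiff 𝕜 1 f) (hinj : Function.Injective (fderiv 𝕜 f x)) :
    ∃ e : OpenPartialHomeomorph E E, x ∈ e.source ∧ ⇑e = f := by
  have := FiniteDimensional.complete 𝕜 E
  obtain ⟨f', hf'⟩ := exists_equiv_hasFDerivAt_of_injective
    (hf.differentiable one_ne_zero x) hinj
  exact ⟨hf.contDiffAt.toOpenPartialHomeomorph f hf' one_ne_zero,
    hf.contDiffAt.mem_toOpenPartialHomeomorph_source hf' one_ne_zero, rfl⟩

theorem hasFDerivAt_powerSumMap_snd {J : ℕ} (b Z : Fin J → ℂ) :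
    ∃ D : (Fin J → ℂ) →L[ℂ] (Fin J → ℂ), HasFDerivAt (powerSumMap b) D Z ∧
      ∀ k ℓ, D k ℓ = ∑ i, b i * ((ℓ + 1) * Z i ^ (ℓ : ℕ) * k i) := by
  obtain ⟨D, hD, hDeq⟩ := exists_hasFDerivAt_powerSumMap b Z
  refine ⟨D.comp (ContinuousLinearMap.inr ℂ _ _), ?_, ?_⟩
  · exact hD.comp Z (hasFDerivAt_prodMk_right b Z)
  · intro k ℓ
    simp [hDeq]

/-- When `Z i = Z j`, columns `i` and `j` of the Jacobian are proportional in the ratio `b i : b j`,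
which dictates the kernel vector. -/
theorem exists_fderiv_powerSumMap_eq_zero {J : ℕ} {b Z : Fin J → ℂ} (hb : ∀ i, b i ≠ 0)
    (hZ : Z ∈ partialDiagonals J) : ∃ k ≠ 0, fderiv ℂ (powerSumMap b) Z k = 0 := by
  obtain ⟨i, j, hij, h⟩ := hZ
  obtain ⟨D, hD, hDeq⟩ := hasFDerivAt_powerSumMap_snd b Z
  refine ⟨Pi.single i (b i)⁻¹ - Pi.single j (b j)⁻¹, ?_, ?_⟩
  · intro h0
    have := congrFun h0 i
    simp [hij, hb i] at this
  · rw [hD.fderiv]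
    funext ℓ
    rw [hDeq]
    simp only [Pi.sub_apply, mul_sub, Finset.sum_sub_distrib, Pi.single_apply, mul_ite, mul_zero,
      Finset.sum_ite_eq', Finset.mem_univ, if_true, h]
    have h1 := hb i
    have h2 := hb j
    simp only [Pi.zero_apply]
    field_simp
    ring

theorem injective_of_notMem_partialDiagonals {J : ℕ} {Z : Fin J → ℂ}
    (hZ : Z ∉ partialDiagonals J) : Function.Injective Z := by
  intro i j h
  by_contra hij
  exact hZ ⟨i, j, hij, h⟩

/-- This factorisation passes kernel vectors on to `coeffMap`; the one through `newtonInv` below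
passes on injectivity. The derivative of `newtonMap` never has to be inverted. -/
theorem fderiv_coeffMap_eq_comp {J : ℕ} (b : Fin J → ℝ) (Z : Fin J → ℂ) :
    fderiv ℂ (coeffMap b) Z =
      (fderiv ℂ newtonMap (powerSumMap (fun i => (b i : ℂ)) Z)).comp
        (fderiv ℂ (powerSumMap fun i => (b i : ℂ)) Z) := by
  obtain ⟨D, hD, -⟩ := hasFDerivAt_powerSumMap_snd (fun i => (b i : ℂ)) Z
  have : coeffMap b = newtonMap ∘ powerSumMap (fun i => (b i : ℂ)) :=
    funext (coeffMap_eq_newtonMap b)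
  rw [this]
  exact fderiv_comp Z (contDiff_newtonMap.differentiable (one_ne_zero) _) hD.differentiableAt

theorem fderiv_powerSumMap_eq_comp {J : ℕ} (b : Fin J → ℝ) (Z : Fin J → ℂ) :
    fderiv ℂ (powerSumMap fun i => (b i : ℂ)) Z =
      (fderiv ℂ newtonInv (coeffMap b Z)).comp (fderiv ℂ (coeffMap b) Z) := by
  have : powerSumMap (fun i => (b i : ℂ)) = newtonInv ∘ coeffMap b :=
    (funext (newtonInv_coeffMap b)).symm
  rw [this]
  exact fderiv_comp Z (contDiff_newtonInv.differentiable (one_ne_zero) _)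
    ((contDiff_coeffMap b).differentiable one_ne_zero _)

theorem injective_fderiv_powerSumMap {J : ℕ} {b Z : Fin J → ℂ} (hb : ∀ i, b i ≠ 0)
    (hZ : Function.Injective Z) : Function.Injective (fderiv ℂ (powerSumMap b) Z) := by
  obtain ⟨D, hD, hDeq⟩ := hasFDerivAt_powerSumMap_snd b Z
  rw [hD.fderiv, injective_iff_map_eq_zero]
  intro k hk
  refine eq_zero_of_sum_mul_pow_eq_zero hb hZ fun ℓ => ?_
  rw [← hDeq, hk, Pi.zero_apply]

theorem injective_fderiv_coeffMap {J : ℕ} {b : Fin J → ℝ} {Z : Fin J → ℂ} (hb : ∀ i, b i ≠ 0)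
    (hZ : Function.Injective Z) : Function.Injective (fderiv ℂ (coeffMap b) Z) := by
  have h := injective_fderiv_powerSumMap (b := fun i => (b i : ℂ)) (by simpa using hb) hZ
  rw [fderiv_powerSumMap_eq_comp, ContinuousLinearMap.coe_comp] at h
  exact h.of_comp

theorem isOpen_injective {J : ℕ} : IsOpen {Z : Fin J → ℂ | Function.Injective Z} := by
  have : {Z : Fin J → ℂ | Function.Injective Z} =
      ⋂ (i : Fin J) (j : Fin J) (_ : i ≠ j), {Z | Z i ≠ Z j} := by
    ext Z
    simp only [Function.Injective, Set.mem_ofPred_eq, Set.mem_iInter]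
    exact forall₂_congr fun i j => not_imp_not.symm
  rw [this]
  refine isOpen_iInter_of_finite fun i => isOpen_iInter_of_finite fun j =>
    isOpen_iInter_of_finite fun _ => ?_
  exact isOpen_ne_fun (continuous_apply i) (continuous_apply j)

theorem isLocalBiholomorphAt_coeffMap {J : ℕ} {b : Fin J → ℝ} {Z : Fin J → ℂ}
    (hb : ∀ i, b i ≠ 0) (hZ : Function.Injective Z) : IsLocalBiholomorphAt (coeffMap b) Z := by
  obtain ⟨e, heZ, he⟩ := exists_openPartialHomeomorph_of_injective (𝕜 := ℂ)
    (contDiff_coeffMap b) (injective_fderiv_coeffMap hb hZ)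
  -- On injective tuples the derivative is invertible everywhere, so the inverse is differentiable
  -- on the whole restricted target.
  refine ⟨e.restrOpen _ isOpen_injective, ⟨heZ, hZ⟩, ?_, ?_, ?_⟩
  · intro W _
    exact congrFun he.symm W
  · change DifferentiableOn ℂ e _
    rw [he]
    exact ((contDiff_coeffMap b).differentiable one_ne_zero).differentiableOn
  · intro A hA
    have hA' : A ∈ e.target := hA.1
    have hinj : Function.Injective (e.symm A) :=
      ((e.restrOpen _ isOpen_injective).map_target hA).2
    obtain ⟨f', hf'⟩ := exists_equiv_hasFDerivAt_of_injective
      ((contDiff_coeffMap b).differentiable one_ne_zero (e.symm A))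
      (injective_fderiv_coeffMap hb hinj)
    rw [← he] at hf'
    exact (e.hasFDerivAt_symm hA' hf').differentiableAt.differentiableWithinAt

theorem not_isLocalBiholomorphAt_coeffMap {J : ℕ} {b : Fin J → ℝ} {Z : Fin J → ℂ}
    (hb : ∀ i, b i ≠ 0) (hZ : Z ∈ partialDiagonals J) :
    ¬ IsLocalBiholomorphAt (coeffMap b) Z := by
  rintro ⟨e, heZ, hFe, hd, hds⟩
  obtain ⟨k, hk0, hk⟩ := exists_fderiv_powerSumMap_eq_zero (b := fun i => (b i : ℂ))
    (by simpa using hb) hZ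
  have hk' : fderiv ℂ (coeffMap b) Z k = 0 := by
    rw [fderiv_coeffMap_eq_comp, ContinuousLinearMap.comp_apply, hk, map_zero]
  have hFd : HasFDerivAt (coeffMap b) (fderiv ℂ (coeffMap b) Z) Z :=
    ((contDiff_coeffMap b).differentiable one_ne_zero Z).hasFDerivAt
  have hsymm : DifferentiableAt ℂ e.symm (coeffMap b Z) := by
    rw [hFe heZ]
    exact hds.differentiableAt (e.open_target.mem_nhds (e.map_source heZ))
  have hcomp := hsymm.hasFDerivAt.comp Z hFd
  have hid : e.symm ∘ coeffMap b =ᶠ[𝓝 Z] id := by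
    filter_upwards [e.open_source.mem_nhds heZ] with W hW
    rw [Function.comp_apply, hFe hW, e.left_inv hW, id]
  have := (hcomp.congr_of_eventuallyEq hid.symm).unique (hasFDerivAt_id Z)
  have h2 := DFunLike.congr_fun this k
  rw [ContinuousLinearMap.comp_apply, hk', map_zero] at h2
  exact hk0 h2.symm

theorem ramificationLocus_coeffMap {J : ℕ} {b : Fin J → ℝ} (hb : ∀ i, b i ≠ 0) :
    ramificationLocus (coeffMap b) = partialDiagonals J := by
  ext Z
  constructor
  · intro h
    by_contra hZ
    exact h (isLocalBiholomorphAt_coeffMap hb (injective_of_notMem_partialDiagonals hZ))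
  · exact not_isLocalBiholomorphAt_coeffMap hb

end Calculus

/-! ### Properness, and families with varying weights -/

section Proper

theorem powerSum_smul {J : ℕ} (b Z : Fin J → ℂ) (c : ℂ) (k : ℕ) :
    powerSum b (c • Z) k = c ^ (k + 1) * powerSum b Z k := by
  simp only [powerSum, Finset.mul_sum, Pi.smul_apply, smul_eq_mul, mul_pow]
  exact Finset.sum_congr rfl fun i _ => by ring

/-- A bound from below for the weighted power sums, uniform for weights near `b₀`. -/
theorem exists_lt_norm_powerSumMap {J : ℕ} {b₀ : Fin J → ℂ} (hb : NondegenerateWeights b₀) :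
    ∃ c > 0, ∀ᶠ b in 𝓝 b₀, ∀ Z : Fin J → ℂ, Z ≠ 0 →
      ∃ ℓ : Fin J, c * ‖Z‖ ^ ((ℓ : ℕ) + 1) < ‖powerSumMap b Z ℓ‖ := by
  have hcont : Continuous fun q : (Fin J → ℂ) × (Fin J → ℂ) => ‖powerSumMap q.1 q.2‖ :=
    (contDiff_powerSumMap (m := 0)).continuous.norm
  have hpos : ∀ Z ∈ Metric.sphere (0 : Fin J → ℂ) 1, 0 < ‖powerSumMap b₀ Z‖ := by
    intro Z hZ
    rw [norm_pos_iff]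
    intro h0
    have : Z = 0 := eq_zero_of_powerSum_eq_zero hb fun k hk => congrFun h0 ⟨k, hk⟩
    simp [this] at hZ
  obtain ⟨c, hc, hcZ⟩ : ∃ c > 0, ∀ Z ∈ Metric.sphere (0 : Fin J → ℂ) 1,
      c < ‖powerSumMap b₀ Z‖ := by
    -- The sphere is empty when `J = 0`.
    rcases (Metric.sphere (0 : Fin J → ℂ) 1).eq_empty_or_nonempty with he | hne
    · exact ⟨1, one_pos, by simp [he]⟩
    · obtain ⟨W, hW, hmin⟩ := (isCompact_sphere (0 : Fin J → ℂ) 1).exists_isMinOn hne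
        (hcont.comp (Continuous.prodMk_right b₀)).continuousOn
      refine ⟨‖powerSumMap b₀ W‖ / 2, half_pos (hpos W hW), fun Z hZ => ?_⟩
      exact (half_lt_self (hpos W hW)).trans_le (hmin hZ)
  refine ⟨c, hc, ?_⟩
  -- Compactness makes the strict bound persist for nearby weights, simultaneously on the whole
  -- sphere; homogeneity then extends it to all `Z ≠ 0`.
  have hev := (isCompact_sphere (0 : Fin J → ℂ) 1).eventually_forall_of_forall_eventually
    (x₀ := b₀) (P := fun b Z => c < ‖powerSumMap b Z‖) fun Z hZ =>
      (hcont.tendsto (b₀, Z)).eventually (lt_mem_nhds (hcZ Z hZ))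
  filter_upwards [hev] with b hb' Z hZ
  have hZ0 : 0 < ‖Z‖ := norm_pos_iff.2 hZ
  have hu : ((‖Z‖ : ℂ)⁻¹ • Z) ∈ Metric.sphere (0 : Fin J → ℂ) 1 := by
    rw [mem_sphere_zero_iff_norm, norm_smul, norm_inv, Complex.norm_real, norm_norm,
      inv_mul_cancel₀ hZ0.ne']
  have h1 := hb' _ hu
  by_contra! hcon
  refine absurd h1 (not_lt.2 ((pi_norm_le_iff_of_nonneg hc.le).2 fun ℓ => ?_))
  rw [powerSumMap, powerSum_smul, norm_mul, norm_pow, norm_inv, Complex.norm_real, norm_norm,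
    inv_pow, inv_mul_le_iff₀ (by positivity), mul_comm]
  exact hcon ℓ

/-- The summand 1 covers `‖Z‖ ≤ 1`; beyond it every positive power of `‖Z‖` dominates `‖Z‖`,
whichever `ℓ` occurs. -/
theorem norm_le_of_lt_norm_powerSumMap {J : ℕ} {b Z : Fin J → ℂ} {c : ℝ} (hc : 0 < c)
    (h : Z ≠ 0 → ∃ ℓ : Fin J, c * ‖Z‖ ^ ((ℓ : ℕ) + 1) < ‖powerSumMap b Z ℓ‖) :
    ‖Z‖ ≤ 1 + ‖powerSumMap b Z‖ / c := by
  have h0 : 0 ≤ ‖powerSumMap b Z‖ / c := by positivity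
  by_contra! hcon
  have h1 : 1 < ‖Z‖ := by linarith
  obtain ⟨ℓ, hℓ⟩ := h (by rintro rfl; simp at h1; linarith)
  have h2 : c * ‖Z‖ ≤ c * ‖Z‖ ^ ((ℓ : ℕ) + 1) := by
    gcongr
    exact le_self_pow₀ h1.le (Nat.succ_ne_zero _)
  have h3 : ‖Z‖ ≤ ‖powerSumMap b Z‖ / c := by
    rw [le_div_iff₀ hc, mul_comm]
    exact h2.trans (hℓ.le.trans (norm_le_pi_norm _ ℓ))
  linarith

/-- The family of power sum maps with weights varying over `S`. -/
def powerSumFamily {J : ℕ} {S : Type*} (γ : S → Fin J → ℂ) (q : S × (Fin J → ℂ)) :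
    S × (Fin J → ℂ) :=
  (q.1, powerSumMap (γ q.1) q.2)

variable {J : ℕ} {S : Type*} [TopologicalSpace S] {γ : S → Fin J → ℂ}

theorem continuous_powerSumFamily (hγ : Continuous γ) : Continuous (powerSumFamily γ) := by
  refine continuous_fst.prodMk ?_
  exact (contDiff_powerSumMap (m := 0)).continuous.comp
    ((hγ.comp continuous_fst).prodMk continuous_snd)

theorem isProperMap_powerSumFamily [T2Space S] (hγ : Continuous γ) (hb : ∀ s, NondegenerateWeights (γ s)) :
    IsProperMap (powerSumFamily γ) := by
  rw [isProperMap_iff_ultrafilter_of_t2]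
  refine ⟨continuous_powerSumFamily hγ, ?_⟩
  rintro 𝒰 ⟨s, a⟩ h
  have hs : Tendsto Prod.fst (𝒰 : Filter (S × (Fin J → ℂ))) (𝓝 s) :=
    (nhds_prod_eq (x := s) (y := a) ▸ h).fst
  have ha : Tendsto (fun q => powerSumMap (γ q.1) q.2) (𝒰 : Filter (S × (Fin J → ℂ))) (𝓝 a) :=
    (nhds_prod_eq (x := s) (y := a) ▸ h).snd
  obtain ⟨c, hc, hev⟩ := exists_lt_norm_powerSumMap (hb s)
  have hbdd : ∀ᶠ q in (𝒰 : Filter (S × (Fin J → ℂ))),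
      q.2 ∈ Metric.closedBall (0 : Fin J → ℂ) (1 + (‖a‖ + 1) / c) := by
    have h1 : ∀ᶠ q in (𝒰 : Filter (S × (Fin J → ℂ))), ‖powerSumMap (γ q.1) q.2‖ < ‖a‖ + 1 :=
      ha.norm.eventually (gt_mem_nhds (lt_add_one _))
    filter_upwards [h1, ((hγ.tendsto s).comp hs).eventually hev] with q hq1 hq2
    rw [mem_closedBall_zero_iff]
    refine (norm_le_of_lt_norm_powerSumMap hc (hq2 q.2)).trans ?_
    gcongr
    exact hq1.le
  obtain ⟨Z, -, hZ⟩ := (isCompact_closedBall (0 : Fin J → ℂ) _).ultrafilter_le_nhds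
    (𝒰.map Prod.snd) (le_principal_iff.2 hbdd)
  have hle : (𝒰 : Filter (S × (Fin J → ℂ))) ≤ 𝓝 (s, Z) := by
    rw [nhds_prod_eq]
    exact le_prod.2 ⟨hs, hZ⟩
  exact ⟨(s, Z), hle⟩

theorem isProperMap_coeffMap {b : Fin J → ℝ} (hb : NondegenerateWeights b) :
    IsProperMap (coeffMap b) := by
  rw [isProperMap_iff_isCompact_preimage]
  refine ⟨(contDiff_coeffMap b (m := 0)).continuous, fun K hK => ?_⟩
  obtain ⟨c, hc, hev⟩ := exists_lt_norm_powerSumMap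
    (hb.map Complex.ofRealHom Complex.ofReal_injective)
  have hbdd := (hK.image (contDiff_newtonInv (m := 0)).continuous).isBounded
  obtain ⟨M, hM⟩ := hbdd.exists_norm_le
  refine Metric.isCompact_of_isClosed_isBounded
    (hK.isClosed.preimage (contDiff_coeffMap b (m := 0)).continuous) ?_
  refine (Metric.isBounded_closedBall (x := (0 : Fin J → ℂ)) (r := 1 + M / c)).subset ?_
  intro Z hZ
  rw [mem_closedBall_zero_iff]
  refine (norm_le_of_lt_norm_powerSumMap hc (hev.self_of_nhds Z)).trans ?_
  gcongr
  refine hM _ ⟨coeffMap b Z, hZ, ?_⟩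
  exact newtonInv_coeffMap b Z

theorem isLocalHomeomorphOn_powerSumFamily (hγ : Continuous γ)
    (hb : ∀ s, NondegenerateWeights (γ s)) :
    IsLocalHomeomorphOn (powerSumFamily γ) {q | Function.Injective q.2} := by
  rintro ⟨s, Z⟩ hZ
  -- `S` is only a topological space, so the inverse function theorem is applied to the universal
  -- family over all weights and the local inverse is pulled back along `γ`.
  have hΦ : ContDiff ℂ 1 (powerSumFamily (id : (Fin J → ℂ) → Fin J → ℂ)) :=
    contDiff_fst.prodMk contDiff_powerSumMap
  obtain ⟨D, hD, hDeq⟩ := exists_hasFDerivAt_powerSumMap (γ s) Z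
  have hΦ' : HasFDerivAt (powerSumFamily (id : (Fin J → ℂ) → Fin J → ℂ))
      ((ContinuousLinearMap.fst ℂ _ _).prod D) (γ s, Z) := hasFDerivAt_fst.prodMk hD
  obtain ⟨e, hes, he⟩ := exists_openPartialHomeomorph_of_injective (𝕜 := ℂ) (x := (γ s, Z)) hΦ (by
    rw [hΦ'.fderiv, injective_iff_map_eq_zero]
    rintro ⟨h, k⟩ hhk
    obtain ⟨rfl, hk⟩ := Prod.mk.inj hhk
    refine Prod.ext rfl (eq_zero_of_sum_mul_pow_eq_zero (hb s).ne_zero hZ fun ℓ => ?_)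
    have := hDeq 0 k ℓ
    change D (0, k) = 0 at hk
    rw [hk] at this
    simpa using this.symm)
  have hfst : ∀ y ∈ e.target, (e.symm y).1 = y.1 := by
    intro y hy
    have := congrArg Prod.fst (e.right_inv hy)
    rwa [he] at this
  have hsrc : ∀ q : S × (Fin J → ℂ), e (γ q.1, q.2) = (γ q.1, powerSumMap (γ q.1) q.2) := by
    intro q
    rw [he]
    rfl
  have htgt : ∀ q : S × (Fin J → ℂ), (γ q.1, q.2) ∈ e.target →
      (γ q.1, (e.symm (γ q.1, q.2)).2) = e.symm (γ q.1, q.2) :=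
    fun q hq => Prod.ext (hfst _ hq).symm rfl
  have hc : Continuous fun q : S × (Fin J → ℂ) => (γ q.1, q.2) :=
    (hγ.comp continuous_fst).prodMk continuous_snd
  refine ⟨
    { toFun := powerSumFamily γ
      invFun := fun q => (q.1, (e.symm (γ q.1, q.2)).2)
      source := (fun q : S × (Fin J → ℂ) => (γ q.1, q.2)) ⁻¹' e.source
      target := (fun q : S × (Fin J → ℂ) => (γ q.1, q.2)) ⁻¹' e.target
      map_source' := ?_
      map_target' := ?_
      left_inv' := ?_
      right_inv' := ?_
      continuousOn_toFun := (continuous_powerSumFamily hγ).continuousOn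
      continuousOn_invFun := continuous_fst.continuousOn.prodMk
        (continuous_snd.comp_continuousOn
          (e.continuousOn_symm.comp hc.continuousOn fun q hq => hq))
      open_source := e.open_source.preimage hc
      open_target := e.open_target.preimage hc }, hes, rfl⟩
  · intro q hq
    have := e.map_source hq
    rwa [hsrc] at this
  · intro q hq
    change (γ q.1, (e.symm (γ q.1, q.2)).2) ∈ e.source
    rw [htgt q hq]
    exact e.map_target hq
  · intro q hq
    refine Prod.ext rfl ?_
    change (e.symm (γ q.1, powerSumMap (γ q.1) q.2)).2 = q.2
    rw [← hsrc, e.left_inv hq]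
  · intro q hq
    refine Prod.ext rfl ?_
    change (γ q.1, powerSumMap (γ q.1) (e.symm (γ q.1, q.2)).2).2 = q.2
    rw [← hsrc (q.1, (e.symm (γ q.1, q.2)).2)]
    change (e (γ q.1, (e.symm (γ q.1, q.2)).2)).2 = q.2
    rw [htgt q hq, e.right_inv hq]

end Proper

end WeightedCluster

end

noncomputable section

namespace WeightedCluster

open Filter Topology MeasureTheory

/-! ### Coverings and local constancy of fibre cardinality -/

section Fibers

variable {X Y : Type*} [TopologicalSpace X] [TopologicalSpace Y] {f : X → Y}

theorem exists_openPartialHomeomorph_of_isLocalHomeomorphOn {t : Set Y}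
    (h : IsLocalHomeomorphOn f (f ⁻¹' t)) {y : Y} (hy : y ∈ t) :
    ∀ x ∈ f ⁻¹' {y}, ∃ φ : OpenPartialHomeomorph X Y, x ∈ φ.source ∧ φ = f := by
  rintro x rfl
  obtain ⟨φ, hx, hφ⟩ := h x hy
  exact ⟨φ, hx, hφ.symm⟩

/-- Fibres are compact by properness and discrete by local injectivity, hence finite; closedness of
the map then gives even covering. -/
theorem _root_.IsProperMap.isCoveringMapOn [T2Space X] {t : Set Y} (hf : IsProperMap f)
    (h : IsLocalHomeomorphOn f (f ⁻¹' t)) : IsCoveringMapOn f t :=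
  hf.isClosedMap.isCoveringMapOn_of_isLocalHomeomorphOn (fun _ hy =>
    ((isProperMap_iff_isClosedMap_and_compact_fibers.1 hf).2.2 _).finite
      (IsDiscrete.of_openPartialHomeomorph f subset_rfl
        (exists_openPartialHomeomorph_of_isLocalHomeomorphOn h hy))) h

theorem _root_.IsEvenlyCovered.eventually_ncard_eq {y : Y} {I : Type*} [TopologicalSpace I]
    (h : IsEvenlyCovered f y I) :
    ∀ᶠ y' in 𝓝 y, (f ⁻¹' {y'}).ncard = (f ⁻¹' {y}).ncard := by
  have hy := Nat.card_congr h.fiberHomeomorph.toEquiv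
  obtain ⟨hI, U, hyU, hU, hfU, H, hH⟩ := h
  filter_upwards [hU.mem_nhds hyU] with y' hy'
  have h' : IsEvenlyCovered f y' I := ⟨hI, U, hy', hU, hfU, H, hH⟩
  exact (Nat.card_congr h'.fiberHomeomorph.toEquiv).symm.trans hy

theorem ncard_preimage_powerSumFamily {J : ℕ} {S : Type*} (γ : S → Fin J → ℂ) (s : S)
    (a : Fin J → ℂ) :
    (powerSumFamily γ ⁻¹' {(s, a)}).ncard = (powerSumMap (γ s) ⁻¹' {a}).ncard := by
  rw [← Set.ncard_image_of_injective (powerSumMap (γ s) ⁻¹' {a}) (Prod.mk_right_injective s)]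
  congr 1
  ext ⟨s', Z⟩
  constructor
  · intro h
    obtain ⟨rfl, h2⟩ := Prod.mk.inj h
    exact ⟨Z, h2, rfl⟩
  · rintro ⟨W, hW, h⟩
    obtain ⟨rfl, rfl⟩ := Prod.mk.inj h
    exact Prod.ext rfl hW

theorem eventually_ncard_powerSumMap_eq {J : ℕ} {S : Type*} [TopologicalSpace S] [T2Space S]
    {γ : S → Fin J → ℂ} (hγ : Continuous γ) (hb : ∀ s, NondegenerateWeights (γ s)) {s : S}
    {a : Fin J → ℂ} (ha : ∀ Z ∈ partialDiagonals J, powerSumMap (γ s) Z ≠ a) :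
    ∀ᶠ q in 𝓝 (s, a), (powerSumMap (γ q.1) ⁻¹' {q.2}).ncard =
      (powerSumMap (γ s) ⁻¹' {a}).ncard := by
  have hcov : IsCoveringMapOn (powerSumFamily γ) {(s, a)} := by
    refine (isProperMap_powerSumFamily hγ hb).isCoveringMapOn
      fun q hq => isLocalHomeomorphOn_powerSumFamily hγ hb q ?_
    obtain ⟨hs, hq2⟩ := Prod.mk.inj (Set.mem_singleton_iff.1 hq)
    refine injective_of_notMem_partialDiagonals fun hd => ha _ hd ?_
    rw [← hq2, hs]
  filter_upwards [(hcov (s, a) rfl).eventually_ncard_eq] with q hq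
  rwa [← ncard_preimage_powerSumFamily, ← ncard_preimage_powerSumFamily]

end Fibers

/-! ### Generic targets, by Sard's theorem in equal dimensions -/

section Sard

variable {E : Type*} [NormedAddCommGroup E] [NormedSpace ℝ E] [FiniteDimensional ℝ E]
  [MeasurableSpace E] [BorelSpace E] (μ : Measure E) [μ.IsAddHaarMeasure]

/-- Critical values form a null set, and the fibre over a regular value is discrete and Lindelöf. -/
theorem ae_countable_preimage {g : E → E} (hg : ContDiff ℝ 1 g) :
    ∀ᵐ a ∂μ, (g ⁻¹' {a}).Countable := by
  have hnull : μ (g '' {x | (fderiv ℝ g x).det = 0}) = 0 :=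
    addHaar_image_eq_zero_of_det_fderivWithin_eq_zero μ
      (fun x _ => (hg.differentiable one_ne_zero x).hasFDerivAt.hasFDerivWithinAt) fun x hx => hx
  filter_upwards [compl_mem_ae_iff.2 hnull] with a ha
  have hd : IsDiscrete (g ⁻¹' {a}) := by
    refine IsDiscrete.of_openPartialHomeomorph g subset_rfl fun x hx => ?_
    refine exists_openPartialHomeomorph_of_injective (𝕜 := ℝ) hg ?_
    by_contra hinj
    refine ha ⟨x, ?_, hx⟩
    change LinearMap.det (fderiv ℝ g x : E →ₗ[ℝ] E) = 0
    rw [LinearMap.det_eq_zero_iff_ker_ne_bot]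
    exact fun hker => hinj (LinearMap.ker_eq_bot.1 hker)
  have := FiniteDimensional.proper ℝ E
  exact (HereditarilyLindelofSpace.isLindelof (g ⁻¹' {a})).countable hd.1

theorem ae_forall_ne_of_fderiv_eq_zero {g : E → E} (hg : ContDiff ℝ 1 g) {s : Set E}
    (hs : ∀ x ∈ s, ∃ v ≠ 0, fderiv ℝ g x v = 0) : ∀ᵐ a ∂μ, ∀ x ∈ s, g x ≠ a := by
  have hnull : μ (g '' s) = 0 :=
    addHaar_image_eq_zero_of_det_fderivWithin_eq_zero μ
      (fun x _ => (hg.differentiable one_ne_zero x).hasFDerivAt.hasFDerivWithinAt) fun x hx => by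
        obtain ⟨v, hv0, hv⟩ := hs x hx
        change LinearMap.det (fderiv ℝ g x : E →ₗ[ℝ] E) = 0
        rw [LinearMap.det_eq_zero_iff_ker_ne_bot]
        intro hker
        exact hv0 (LinearMap.ker_eq_bot'.1 hker v hv)
  filter_upwards [compl_mem_ae_iff.2 hnull] with a ha x hx h
  exact ha ⟨x, hx, h⟩

theorem ae_forall_powerSumMap_ne {J : ℕ} {b : Fin J → ℂ} (hb : ∀ i, b i ≠ 0) :
    ∀ᵐ a : Fin J → ℂ, ∀ Z ∈ partialDiagonals J, powerSumMap b Z ≠ a := by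
  have hP : ContDiff ℂ 1 (powerSumMap b) :=
    contDiff_powerSumMap.comp (contDiff_const.prodMk contDiff_id)
  refine ae_forall_ne_of_fderiv_eq_zero _ (hP.restrict_scalars ℝ) fun Z hZ => ?_
  obtain ⟨k, hk0, hk⟩ := exists_fderiv_powerSumMap_eq_zero hb hZ
  refine ⟨k, hk0, ?_⟩
  rw [(hP.differentiable one_ne_zero Z).fderiv_restrictScalars ℝ]
  exact hk

/-- The weights on the line through `(1, …, 1)` and `b`. -/
def weightLine {J : ℕ} (b : Fin J → ℂ) (s : ℂ) (i : Fin J) : ℂ := 1 - s + s * b i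

theorem contDiff_weightLine {J : ℕ} (b : Fin J → ℂ) : ContDiff ℂ 1 (weightLine b) := by
  refine contDiff_pi' fun i => ?_
  simp only [weightLine]
  fun_prop

theorem ae_countable_weightLine {J : ℕ} (b : Fin J → ℂ) :
    ∀ᵐ a : Fin J → ℂ,
      {s : ℂ | ∃ Z ∈ partialDiagonals J, powerSumMap (weightLine b s) Z = a}.Countable := by
  -- On the diagonal `z_i = z_j` the slot `j` is redundant, so it stores the parameter `s`. The
  -- pairs of a parameter and a diagonal point thus form a copy of `ℂ ^ J`, of the same dimension as
  -- the target.
  let g (i j : Fin J) (W : Fin J → ℂ) : Fin J → ℂ :=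
    powerSumMap (weightLine b (W j)) (Function.update W j (W i))
  have hg : ∀ i j, ContDiff ℂ 1 (g i j) := by
    intro i j
    have hu : ContDiff ℂ 1 fun W : Fin J → ℂ => Function.update W j (W i) := by
      refine contDiff_pi' fun k => ?_
      simp only [Function.update_apply]
      split_ifs
      · exact contDiff_apply ℂ ℂ i
      · exact contDiff_apply ℂ ℂ k
    exact contDiff_powerSumMap.comp
      (((contDiff_weightLine b).comp (contDiff_apply ℂ ℂ j)).prodMk hu)
  have hae : ∀ᵐ a : Fin J → ℂ, ∀ i j, (g i j ⁻¹' {a}).Countable := by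
    rw [ae_all_iff]
    intro i
    rw [ae_all_iff]
    intro j
    exact ae_countable_preimage _ ((hg i j).restrict_scalars ℝ)
  filter_upwards [hae] with a ha
  refine (Set.countable_iUnion fun i => Set.countable_iUnion fun j =>
    (ha i j).image fun W => W j).mono ?_
  rintro s ⟨Z, ⟨i, j, hij, h⟩, hZ⟩
  refine Set.mem_iUnion₂.2 ⟨i, j, Function.update Z j s, ?_, by simp⟩
  change g i j _ = a
  simp only [g, Function.update_self, Function.update_idem, Function.update_of_ne hij, h,
    Function.update_eq_self]
  exact hZ

end Sard

/-! ### Unit weights: roots of a monic polynomial -/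

section Roots

open Polynomial

theorem expansion_one {J : ℕ} (Z : Fin J → ℂ) :
    expansion 1 Z = ((∏ i, (X - C (Z i)) : ℂ[X]).reverse : PowerSeries ℂ) := by
  classical
  rw [expansion]
  induction (Finset.univ : Finset (Fin J)) using Finset.induction_on with
  | empty =>
    rw [Finset.prod_empty, Finset.prod_empty, ← C_1, reverse_C, C_1, Polynomial.coe_one]
  | insert i s hi ih =>
    rw [Finset.prod_insert hi, Finset.prod_insert hi, ih, reverse_mul_of_domain, Polynomial.coe_mul]
    congr 1
    have h1 : PowerSeries.binomialSeries ℂ ((1 : Fin J → ℝ) i) = 1 + PowerSeries.X := by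
      simpa using PowerSeries.binomialSeries_nat (R := ℝ) (A := ℂ) 1
    rw [h1, map_add, map_one, PowerSeries.rescale_X]
    have h2 : (X - C (Z i)).reverse = 1 + C (-Z i) * X := by
      ext n
      rw [coeff_reverse, natDegree_X_sub_C]
      match n with
      | 0 => simp [revAt_le, coeff_C]
      | 1 => simp [revAt_le, coeff_C, coeff_one]
      | n + 2 =>
        rw [revAt_eq_self_of_lt (by omega)]
        simp [coeff_X, coeff_one]
    rw [h2]
    simp

theorem coeffMap_one {J : ℕ} (Z : Fin J → ℂ) (ℓ : Fin J) :
    coeffMap 1 Z ℓ = (∏ i, (X - C (Z i)) : ℂ[X]).coeff (J - (ℓ + 1)) := by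
  have hdeg : (∏ i, (X - C (Z i)) : ℂ[X]).natDegree = J := by
    rw [natDegree_prod_of_monic _ _ fun i _ => monic_X_sub_C _]
    simp
  rw [coeffMap, expansion_one, Polynomial.coeff_coe, coeff_reverse, hdeg, revAt_le (by omega)]

theorem coeffMap_one_eq_iff {J : ℕ} (Z : Fin J → ℂ) {q : ℂ[X]} (hq : q.Monic)
    (hdeg : q.natDegree = J) :
    (∀ ℓ : Fin J, coeffMap 1 Z ℓ = q.coeff (J - (ℓ + 1))) ↔
      Finset.univ.val.map Z = q.roots := by
  have hm : (∏ i, (X - C (Z i)) : ℂ[X]).Monic := monic_prod_of_monic _ _ fun i _ => monic_X_sub_C _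
  have hd : (∏ i, (X - C (Z i)) : ℂ[X]).natDegree = J := by
    rw [natDegree_prod_of_monic _ _ fun i _ => monic_X_sub_C _]
    simp
  have hr : (∏ i, (X - C (Z i)) : ℂ[X]).roots = Finset.univ.val.map Z := by
    rw [← Polynomial.roots_multiset_prod_X_sub_C (Finset.univ.val.map Z), Multiset.map_map]
    rfl
  constructor
  · intro h
    rw [← hr]
    congr 1
    ext n
    rcases lt_trichotomy n J with hn | hn | hn
    · have := h ⟨J - 1 - n, by omega⟩
      rw [coeffMap_one] at this
      simpa [show J - (J - 1 - n + 1) = n by omega] using this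
    · have h1 := hm.coeff_natDegree
      have h2 := hq.coeff_natDegree
      rw [hd] at h1
      rw [hdeg] at h2
      rw [hn, h1, h2]
    · rw [coeff_eq_zero_of_natDegree_lt (by omega), coeff_eq_zero_of_natDegree_lt (by omega)]
  · intro h ℓ
    have hs := (IsAlgClosed.splits q).eq_prod_roots_of_monic hq
    rw [coeffMap_one, hs, ← h, Multiset.map_map]
    rfl

/-- The fibre consists of the enumerations of the roots of `X ^ J + ∑ A_ℓ X ^ (J - ℓ - 1)`. Avoiding
the diagonals makes the roots distinct, so the enumerations correspond to permutations. -/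
theorem ncard_coeffMap_one {J : ℕ} {A : Fin J → ℂ}
    (hA : ∀ Z ∈ partialDiagonals J, coeffMap 1 Z ≠ A) :
    (coeffMap 1 ⁻¹' {A}).ncard = J.factorial := by
  classical
  let r : ℂ[X] := ∑ ℓ : Fin J, C (A ℓ) * X ^ (J - ((ℓ : ℕ) + 1))
  have hr : r.degree < J := by
    rw [degree_lt_iff_coeff_zero]
    intro n hn
    rw [finsetSum_coeff]
    refine Finset.sum_eq_zero fun ℓ _ => ?_
    rw [coeff_C_mul_X_pow, if_neg (by omega)]
  set q : ℂ[X] := X ^ J + r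
  have hq : q.Monic := monic_X_pow_add hr
  have hdeg : q.natDegree = J := by
    rw [natDegree_add_eq_left_of_degree_lt (by rwa [degree_X_pow]), natDegree_X_pow]
  have hcoeff : ∀ ℓ : Fin J, q.coeff (J - (ℓ + 1)) = A ℓ := by
    intro ℓ
    rw [coeff_add, coeff_X_pow, if_neg (by omega), zero_add, finsetSum_coeff,
      Finset.sum_eq_single ℓ]
    · rw [coeff_C_mul_X_pow, if_pos rfl]
    · intro k _ hk
      rw [coeff_C_mul_X_pow, if_neg]
      intro h
      exact hk (Fin.ext (by omega))
    · simp
  have hiff : ∀ Z, coeffMap 1 Z = A ↔ Finset.univ.val.map Z = q.roots := by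
    intro Z
    rw [← coeffMap_one_eq_iff Z hq hdeg, funext_iff]
    simp only [hcoeff]
  obtain ⟨Z₀, hZ₀⟩ : ∃ Z₀ : Fin J → ℂ, Finset.univ.val.map Z₀ = q.roots := by
    have hcard : q.roots.card = J := by rw [← hdeg]; exact (IsAlgClosed.splits q).natDegree_eq_card_roots.symm
    generalize q.roots = m at hcard
    induction m using Quotient.inductionOn with
    | _ l =>
      have hl : l.length = J := hcard
      subst hl
      exact ⟨l.get, by rw [Fin.univ_val_map, List.ofFn_get]; rfl⟩
  have hinj : Function.Injective Z₀ :=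
    injective_of_notMem_partialDiagonals fun h => hA _ h ((hiff Z₀).2 hZ₀)
  have himage : coeffMap 1 ⁻¹' {A} = Set.range fun σ : Equiv.Perm (Fin J) => Z₀ ∘ σ := by
    ext Z
    rw [Set.mem_preimage, Set.mem_singleton_iff, hiff, ← hZ₀]
    constructor
    · intro h
      have hZinj : Function.Injective Z :=
        injective_of_notMem_partialDiagonals fun hd => hA _ hd ((hiff Z).2 (h.trans hZ₀))
      have hmem : ∀ i, ∃ j, Z₀ j = Z i := by
        intro i
        have : Z i ∈ Finset.univ.val.map Z₀ := by
          rw [← h]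
          exact Multiset.mem_map_of_mem Z (Finset.mem_univ i)
        obtain ⟨j, -, hj⟩ := Multiset.mem_map.1 this
        exact ⟨j, hj⟩
      choose σ hσ using hmem
      have hσinj : Function.Injective σ := fun i j hij => hZinj (by rw [← hσ, hij, hσ])
      exact ⟨Equiv.ofBijective σ (Finite.injective_iff_bijective.1 hσinj), funext hσ⟩
    · rintro ⟨σ, rfl⟩
      rw [← Multiset.map_map, Multiset.map_univ_val_equiv]
  have hσ : Function.Injective fun σ : Equiv.Perm (Fin J) => Z₀ ∘ σ :=
    fun σ τ h => Equiv.ext fun i => hinj (congrFun h i)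
  rw [himage, ← Set.image_univ, Set.ncard_image_of_injective _ hσ, Set.ncard_univ, Nat.card_eq_fintype_card,
    Fintype.card_perm, Fintype.card_fin]

end Roots

/-! ### The number of sheets, by deformation of the weights -/

section Count

theorem ncard_powerSumMap_one {J : ℕ} {a : Fin J → ℂ}
    (ha : ∀ Z ∈ partialDiagonals J, powerSumMap 1 Z ≠ a) :
    (powerSumMap (1 : Fin J → ℂ) ⁻¹' {a}).ncard = J.factorial := by
  have hiff : ∀ Z : Fin J → ℂ, coeffMap 1 Z = newtonMap a ↔ powerSumMap 1 Z = a := by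
    intro Z
    rw [coeffMap_eq_iff, newtonInv_newtonMap]
    simp only [Pi.one_apply, Complex.ofReal_one]
    rfl
  rw [← ncard_coeffMap_one (A := newtonMap a) fun Z hZ h => ha Z hZ ((hiff Z).1 h)]
  congr 1
  ext Z
  exact (hiff Z).symm

/-- Each subset sum is affine in `s` with the nonzero value `I.card` at `s = 0`, so it has at most
one zero. -/
theorem countable_degenerate_weightLine {J : ℕ} (b : Fin J → ℂ) :
    {s : ℂ | ¬ NondegenerateWeights (weightLine b s)}.Countable := by
  have hfin : ∀ I : Finset (Fin J), I.Nonempty →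
      {s : ℂ | ∑ i ∈ I, weightLine b s i = 0}.Subsingleton := by
    intro I hI s hs t ht
    have hI' : (I.card : ℂ) ≠ 0 := by exact_mod_cast hI.card_ne_zero
    simp only [weightLine, Set.mem_ofPred_eq, Finset.sum_add_distrib, Finset.sum_const,
      nsmul_eq_mul, ← Finset.mul_sum] at hs ht
    have h1 : (I.card : ℂ) * (s - t) = 0 := by linear_combination s * ht - t * hs
    exact sub_eq_zero.1 ((mul_eq_zero.1 h1).resolve_left hI')
  have : {s : ℂ | ¬ NondegenerateWeights (weightLine b s)} ⊆
      ⋃ (I : Finset (Fin J)) (_ : I.Nonempty), {s : ℂ | ∑ i ∈ I, weightLine b s i = 0} := by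
    intro s hs
    simp only [NondegenerateWeights, Set.mem_ofPred_eq, not_forall, not_not] at hs
    obtain ⟨I, hI, h⟩ := hs
    exact Set.mem_iUnion₂.2 ⟨I, hI, h⟩
  exact (Set.countable_iUnion fun I => Set.countable_iUnion fun hI =>
    (hfin I hI).countable).mono this

theorem ncard_powerSumMap {J : ℕ} {b : Fin J → ℂ} (hb : NondegenerateWeights b) {a : Fin J → ℂ}
    (ha : ∀ Z ∈ partialDiagonals J, powerSumMap b Z ≠ a) :
    (powerSumMap b ⁻¹' {a}).ncard = J.factorial := by
  -- With a one-point parameter space the weights stay fixed. The given `a` may thus be replaced by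
  -- a nearby generic `a'` without changing the count.
  have hloc : ∀ᶠ a' in 𝓝 a, (powerSumMap b ⁻¹' {a'}).ncard = (powerSumMap b ⁻¹' {a}).ncard :=
    ((Continuous.prodMk_right PUnit.unit.{1}).tendsto a).eventually
      (eventually_ncard_powerSumMap_eq (S := PUnit.{1}) (γ := fun _ => b) (s := PUnit.unit.{1})
        continuous_const (fun _ => hb) ha)
  have hdense : Dense {a : Fin J → ℂ | (∀ Z ∈ partialDiagonals J, powerSumMap 1 Z ≠ a) ∧
      (∀ Z ∈ partialDiagonals J, powerSumMap b Z ≠ a) ∧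
      {s : ℂ | ∃ Z ∈ partialDiagonals J, powerSumMap (weightLine b s) Z = a}.Countable} := by
    refine Measure.dense_of_ae (μ := volume) ?_
    filter_upwards [ae_forall_powerSumMap_ne (b := (1 : Fin J → ℂ)) fun _ => one_ne_zero,
      ae_forall_powerSumMap_ne hb.ne_zero, ae_countable_weightLine b] with a h1 h2 h3
    exact ⟨h1, h2, h3⟩
  obtain ⟨a', hcard, h1, hb', hcount⟩ := mem_closure_iff_nhds.1 (hdense a) _ hloc
  rw [← hcard, ← ncard_powerSumMap_one h1]
  let G : Set ℂ := ({s | ¬ NondegenerateWeights (weightLine b s)} ∪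
    {s | ∃ Z ∈ partialDiagonals J, powerSumMap (weightLine b s) Z = a'})ᶜ
  have hG : IsPreconnected G :=
    (((countable_degenerate_weightLine b).union hcount).isPathConnected_compl_of_one_lt_rank
      (by rw [Complex.rank_real_complex]; exact Nat.one_lt_ofNat)).isConnected.isPreconnected
  have hmem : ∀ s, s ∈ G ↔ NondegenerateWeights (weightLine b s) ∧
      ∀ Z ∈ partialDiagonals J, powerSumMap (weightLine b s) Z ≠ a' := by
    intro s
    simp [G]
  have hline0 : weightLine b 0 = 1 := by
    funext i
    simp [weightLine]
  have hline1 : weightLine b 1 = b := by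
    funext i
    simp [weightLine]
  have h0G : (0 : ℂ) ∈ G := by
    rw [hmem, hline0]
    refine ⟨fun I hI => ?_, h1⟩
    simpa using hI.ne_empty
  have h1G : (1 : ℂ) ∈ G := by
    rw [hmem, hline1]
    exact ⟨hb, hb'⟩
  have := isPreconnected_iff_preconnectedSpace.1 hG
  have hconst : IsLocallyConstant fun s : G => (powerSumMap (weightLine b s) ⁻¹' {a'}).ncard := by
    rw [IsLocallyConstant.iff_eventually_eq]
    intro s
    exact ((Continuous.prodMk_left a').tendsto s).eventually
      (eventually_ncard_powerSumMap_eq (γ := fun s : G => weightLine b s)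
        ((contDiff_weightLine b).continuous.comp continuous_subtype_val)
        (fun s => ((hmem s).1 s.2).1) ((hmem s).1 s.2).2)
  have := hconst.apply_eq_of_preconnectedSpace ⟨1, h1G⟩ ⟨0, h0G⟩
  simpa only [hline0, hline1] using this

end Count

end WeightedCluster

end

noncomputable section

namespace WeightedCluster

open Filter Topology Asymptotics

/-! ### Differentiability of the logarithmic potential -/

section Potential

variable {J : ℕ}

theorem newtonSum_extendZero_zero (n : ℕ) : newtonSum (extendZero (0 : Fin J → ℂ)) n = 0 := by
  have h0 : ∀ k, extendZero (0 : Fin J → ℂ) k = 0 := fun k => by simp [extendZero]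
  rw [newtonSum]
  simp [h0]

theorem newtonInv_zero : newtonInv (0 : Fin J → ℂ) = 0 :=
  funext fun ℓ => newtonSum_extendZero_zero ℓ

/-- The remaining terms of the recursion are products of two factors vanishing at 0, so they
contribute nothing to first order. -/
theorem hasFDerivAt_newtonInv (ℓ : Fin J) :
    HasFDerivAt (fun A : Fin J → ℂ => newtonInv A ℓ)
      (-((ℓ + 1 : ℂ) • ContinuousLinearMap.proj (R := ℂ) (φ := fun _ : Fin J => ℂ) ℓ)) 0 := by
  have h0 : ∀ k, extendZero (0 : Fin J → ℂ) k = 0 := fun k => by simp [extendZero]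
  have heq : (fun A : Fin J → ℂ => newtonInv A ℓ) = fun A =>
      -((ℓ + 1 : ℂ) • A ℓ) -
        ∑ j : Fin ℓ, newtonSum (extendZero A) j * extendZero A (ℓ - 1 - j) := by
    funext A
    rw [newtonInv, newtonSum, extendZero_val]
  have hlin : HasFDerivAt (fun A : Fin J → ℂ => A ℓ)
      (ContinuousLinearMap.proj (R := ℂ) (φ := fun _ : Fin J => ℂ) ℓ) 0 :=
    (ContinuousLinearMap.proj (R := ℂ) (φ := fun _ : Fin J => ℂ) ℓ).hasFDerivAt
  have hquad : HasFDerivAt (fun A : Fin J → ℂ =>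
      ∑ j : Fin ℓ, newtonSum (extendZero A) j * extendZero A (ℓ - 1 - j))
      (∑ j : Fin ℓ, (0 : (Fin J → ℂ) →L[ℂ] ℂ)) 0 := by
    refine HasFDerivAt.fun_sum fun j _ => ?_
    have h1 : HasFDerivAt (fun A : Fin J → ℂ => newtonSum (extendZero A) j) _ 0 :=
      ((contDiff_newtonSum (m := 1) contDiff_extendZero j).differentiable
        one_ne_zero 0).hasFDerivAt
    have h2 : HasFDerivAt (fun A : Fin J → ℂ => extendZero A (ℓ - 1 - j)) _ 0 :=
      ((contDiff_extendZero (m := 1) (ℓ - 1 - j)).differentiable one_ne_zero 0).hasFDerivAt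
    have h3 := h1.mul h2
    simp only [h0, newtonSum_extendZero_zero] at h3
    convert! h3 using 1
    exact ((congrArg₂ (· + ·) (zero_smul ℂ _) (zero_smul ℂ _)).trans (add_zero _)).symm
  rw [heq]
  convert! (hlin.const_smul (ℓ + 1 : ℂ)).neg.sub hquad using 1
  simp

theorem norm_newtonInv_isBigO : (newtonInv : (Fin J → ℂ) → Fin J → ℂ) =O[𝓝 0] fun A => A := by
  have h := ((contDiff_newtonInv (J := J) (m := 1)).differentiable one_ne_zero 0).isBigO_sub
  simpa [newtonInv_zero] using h

/-- The terms of order `1, …, J` in the expansion of the potential. -/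
def truncatedPotential (b : Fin J → ℝ) (z : ℂ) (a : Fin J → ℂ) : ℝ :=
  ∑ j, b j * Real.log ‖z‖ - (∑ ℓ : Fin J, z⁻¹ ^ ((ℓ : ℕ) + 1) * (a ℓ / (ℓ + 1))).re

theorem logTaylor_neg (n : ℕ) (u : ℂ) :
    Complex.logTaylor (n + 1) (-u) = -∑ k : Fin n, u ^ ((k : ℕ) + 1) / (k + 1) := by
  rw [Complex.logTaylor, Finset.sum_range_succ', ← Fin.sum_univ_eq_sum_range (fun k =>
    (-1 : ℂ) ^ (k + 1 + 1) * (-u) ^ (k + 1) / ((k + 1 : ℕ) : ℂ)), ← Finset.sum_neg_distrib]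
  simp only [Nat.cast_zero, div_zero, add_zero]
  refine Finset.sum_congr rfl fun k _ => ?_
  have : (-1 : ℂ) ^ ((k : ℕ) + 1 + 1) * (-u) ^ ((k : ℕ) + 1) = -u ^ ((k : ℕ) + 1) := by
    rw [neg_pow u, ← mul_assoc, ← pow_add, show (k : ℕ) + 1 + 1 + (k + 1) = 2 * (k + 1) + 1 by ring,
      pow_succ, pow_mul]
    simp
  rw [this, neg_div]
  push_cast
  rfl

theorem truncatedPotential_eq (b : Fin J → ℝ) (z : ℂ) (Z : Fin J → ℂ) :
    truncatedPotential b z (powerSumMap (fun i => (b i : ℂ)) Z) =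
      ∑ j, b j * (Real.log ‖z‖ + (Complex.logTaylor (J + 1) (-(Z j * z⁻¹))).re) := by
  simp only [mul_add, Finset.sum_add_distrib, truncatedPotential, sub_eq_add_neg]
  congr 1
  have : ∑ ℓ : Fin J, z⁻¹ ^ ((ℓ : ℕ) + 1) *
      (powerSumMap (fun i => (b i : ℂ)) Z ℓ / (ℓ + 1)) =
      -∑ j, (b j : ℂ) * Complex.logTaylor (J + 1) (-(Z j * z⁻¹)) := by
    simp only [logTaylor_neg, powerSumMap, powerSum, mul_neg, Finset.sum_neg_distrib, neg_neg,
      Finset.mul_sum, Finset.sum_div]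
    rw [Finset.sum_comm]
    refine Finset.sum_congr rfl fun j _ => Finset.sum_congr rfl fun ℓ _ => ?_
    rw [mul_pow]
    ring
  rw [this, Complex.neg_re, neg_neg, Complex.re_sum]
  simp

theorem norm_logPotential_sub_le (b : Fin J → ℝ) {z : ℂ} (hz : z ≠ 0) {Z : Fin J → ℂ}
    (hZ : ‖Z‖ * ‖z⁻¹‖ ≤ 1 / 2) :
    ‖logPotential b Z z - truncatedPotential b z (powerSumMap (fun i => (b i : ℂ)) Z)‖ ≤
      (∑ j, |b j|) * 2 * ‖z⁻¹‖ ^ (J + 1) * ‖Z‖ ^ (J + 1) := by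
  rw [truncatedPotential_eq, logPotential, ← Finset.sum_sub_distrib, mul_assoc, mul_assoc,
    Finset.sum_mul]
  refine norm_sum_le_of_le _ fun j _ => ?_
  set u := Z j * z⁻¹ with hu
  have hu' : ‖u‖ ≤ ‖Z‖ * ‖z⁻¹‖ := by
    rw [hu, norm_mul]
    gcongr
    exact norm_le_pi_norm Z j
  have hu2 : ‖-u‖ ≤ 1 / 2 := by rw [norm_neg]; exact hu'.trans hZ
  have hu1 : ‖-u‖ < 1 := hu2.trans_lt (by norm_num)
  have hfac : z - Z j = z * (1 + -u) := by
    rw [hu]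
    field_simp
    ring
  have hne : ‖1 + -u‖ ≠ 0 := by
    intro h0
    rw [norm_eq_zero] at h0
    have : -u = -1 := by linear_combination h0
    rw [this] at hu1
    simp at hu1
  rw [hfac, norm_mul, Real.log_mul (norm_ne_zero_iff.2 hz) hne, ← mul_sub,
    add_sub_add_left_eq_sub, ← Complex.log_re, ← Complex.sub_re, norm_mul, Real.norm_eq_abs]
  gcongr
  calc ‖(Complex.log (1 + -u) - Complex.logTaylor (J + 1) (-u)).re‖
      ≤ ‖Complex.log (1 + -u) - Complex.logTaylor (J + 1) (-u)‖ := Complex.abs_re_le_norm _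
    _ ≤ ‖-u‖ ^ (J + 1) * (1 - ‖-u‖)⁻¹ / (J + 1) := Complex.norm_log_sub_logTaylor_le J hu1
    _ ≤ ‖-u‖ ^ (J + 1) * (1 - ‖-u‖)⁻¹ := by
        refine div_le_self ?_ (by linarith [(Nat.cast_nonneg J : (0 : ℝ) ≤ J)])
        have : 0 ≤ 1 - ‖-u‖ := by linarith
        positivity
    _ ≤ (‖Z‖ * ‖z⁻¹‖) ^ (J + 1) * 2 := by
        rw [norm_neg] at hu1 hu2 ⊢
        have : (1 - ‖u‖)⁻¹ ≤ 2 := by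
          rw [inv_le_comm₀ (by linarith) (by norm_num)]
          linarith
        have h0 : 0 ≤ (1 - ‖u‖)⁻¹ := inv_nonneg.2 (by linarith)
        gcongr
    _ = 2 * (‖z⁻¹‖ ^ (J + 1) * ‖Z‖ ^ (J + 1)) := by ring

/-- No continuity of `ζ` is assumed: the lower bound on the power sums forces `ζ A` to be small
whenever `A` is. -/
theorem tendsto_rightInverse {b : Fin J → ℝ} (hb : NondegenerateWeights b)
    {Ω : Set (Fin J → ℂ)} {ζ : (Fin J → ℂ) → Fin J → ℂ}
    (hζ : ∀ A ∈ Ω, coeffMap b (ζ A) = A) : Tendsto ζ (𝓝[Ω] 0) (𝓝 0) := by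
  obtain ⟨c, hc, hev⟩ := exists_lt_norm_powerSumMap
    (hb.map Complex.ofRealHom Complex.ofReal_injective)
  have hinv : Tendsto (fun A : Fin J → ℂ => ‖newtonInv A‖) (𝓝[Ω] 0) (𝓝 0) := by
    have := (contDiff_newtonInv (J := J) (m := 0)).continuous.norm.tendsto 0
    rw [newtonInv_zero, norm_zero] at this
    exact this.mono_left nhdsWithin_le_nhds
  rw [Metric.tendsto_nhds]
  intro ε hε
  -- Since `δ ≤ 1`, the power `δ ^ J` is the smallest of the `δ ^ (ℓ + 1)`, so one threshold serves
  -- every `ℓ`.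
  set δ := min ε 1
  have hδ : 0 < δ := lt_min hε one_pos
  filter_upwards [self_mem_nhdsWithin, hinv.eventually (gt_mem_nhds (by positivity : 0 < c * δ ^ J))]
    with A hA hlt
  rw [dist_zero_right]
  by_contra! hcon
  have hδZ : δ ≤ ‖ζ A‖ := (min_le_left _ _).trans hcon
  obtain ⟨ℓ, hℓ⟩ := hev.self_of_nhds (ζ A) (norm_pos_iff.1 (hε.trans_le hcon))
  have h1 : ‖powerSumMap (fun i => Complex.ofRealHom (b i)) (ζ A) ℓ‖ ≤ ‖newtonInv A‖ := by
    rw [← (coeffMap_eq_iff b (ζ A) A).1 (hζ A hA)]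
    exact norm_le_pi_norm _ ℓ
  have h2 : δ ^ J ≤ ‖ζ A‖ ^ ((ℓ : ℕ) + 1) :=
    (pow_le_pow_of_le_one hδ.le (min_le_right _ _) ℓ.2).trans (by gcongr)
  have h3 : c * δ ^ J ≤ c * ‖ζ A‖ ^ ((ℓ : ℕ) + 1) := by gcongr
  linarith

/-- The lower bound gives `‖ζ A‖ ^ J = O(‖A‖)`, and the extra factor `‖ζ A‖` tends to 0. This is why
truncation after order `J` suffices. -/
theorem norm_pow_isLittleO {b : Fin J → ℝ} (hb : NondegenerateWeights b)
    {Ω : Set (Fin J → ℂ)} {ζ : (Fin J → ℂ) → Fin J → ℂ}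
    (hζ : ∀ A ∈ Ω, coeffMap b (ζ A) = A) :
    (fun A => ‖ζ A‖ ^ (J + 1)) =o[𝓝[Ω] 0] fun A => A := by
  obtain ⟨c, hc, hev⟩ := exists_lt_norm_powerSumMap
    (hb.map Complex.ofRealHom Complex.ofReal_injective)
  have ht := tendsto_rightInverse hb hζ
  have hO : (fun A => ‖ζ A‖ ^ (J + 1)) =O[𝓝[Ω] 0] fun A => ‖ζ A‖ * ‖newtonInv A‖ := by
    refine IsBigO.of_bound c⁻¹ ?_
    filter_upwards [self_mem_nhdsWithin, Metric.tendsto_nhds.1 ht 1 one_pos] with A hA h1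
    rw [dist_zero_right] at h1
    rw [Real.norm_of_nonneg (by positivity), Real.norm_of_nonneg (by positivity), pow_succ',
      ← mul_assoc, mul_comm c⁻¹, mul_assoc]
    rcases eq_or_ne (ζ A) 0 with h0 | h0
    · simp [h0]
    · obtain ⟨ℓ, hℓ⟩ := hev.self_of_nhds (ζ A) h0
      have h2 : ‖powerSumMap (fun i => Complex.ofRealHom (b i)) (ζ A) ℓ‖ ≤ ‖newtonInv A‖ := by
        rw [← (coeffMap_eq_iff b (ζ A) A).1 (hζ A hA)]
        exact norm_le_pi_norm _ ℓ
      have h3 : ‖ζ A‖ ^ J ≤ ‖ζ A‖ ^ ((ℓ : ℕ) + 1) :=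
        pow_le_pow_of_le_one (norm_nonneg _) h1.le ℓ.2
      gcongr
      rw [le_inv_mul_iff₀ hc]
      calc c * ‖ζ A‖ ^ J ≤ c * ‖ζ A‖ ^ ((ℓ : ℕ) + 1) := by gcongr
        _ ≤ _ := hℓ.le.trans h2
  refine hO.trans_isLittleO ?_
  have h1 : (fun A => ‖ζ A‖) =o[𝓝[Ω] 0] fun _ => (1 : ℝ) :=
    (isLittleO_one_iff ℝ).2 (by simpa using ht.norm)
  have h2 := h1.mul_isBigO (norm_newtonInv_isBigO.norm_norm.mono (nhdsWithin_le_nhds (s := Ω)))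
  rw [← isLittleO_norm_right]
  simpa using h2

theorem hasFDerivAt_truncatedPotential (b : Fin J → ℝ) (z : ℂ) :
    HasFDerivAt (fun A => truncatedPotential b z (newtonInv A))
      (Complex.reCLM.comp ((∑ ℓ : Fin J, z⁻¹ ^ ((ℓ : ℕ) + 1) •
        ContinuousLinearMap.proj (R := ℂ) (φ := fun _ : Fin J => ℂ) ℓ).restrictScalars ℝ)) 0 := by
  have h1 : HasFDerivAt (fun A : Fin J → ℂ =>
      ∑ ℓ : Fin J, z⁻¹ ^ ((ℓ : ℕ) + 1) * (newtonInv A ℓ / (ℓ + 1)))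
      (-∑ ℓ : Fin J, z⁻¹ ^ ((ℓ : ℕ) + 1) •
        ContinuousLinearMap.proj (R := ℂ) (φ := fun _ : Fin J => ℂ) ℓ) 0 := by
    rw [← Finset.sum_neg_distrib]
    refine HasFDerivAt.fun_sum fun ℓ _ => ?_
    have hne : ((ℓ : ℂ) + 1) ≠ 0 := by exact_mod_cast (ℓ : ℕ).succ_ne_zero
    have := (hasFDerivAt_newtonInv ℓ).const_mul (z⁻¹ ^ ((ℓ : ℕ) + 1) * (ℓ + 1 : ℂ)⁻¹)
    convert! this using 1
    · funext A
      ring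
    · ext A
      simp
      field_simp
  have h2 := (Complex.reCLM.hasFDerivAt (x := ∑ ℓ : Fin J, z⁻¹ ^ ((ℓ : ℕ) + 1) *
    (newtonInv (0 : Fin J → ℂ) ℓ / (ℓ + 1)))).comp 0 (h1.restrictScalars ℝ)
  have h3 := h2.const_sub (∑ j, b j * Real.log ‖z‖)
  convert! h3 using 1
  ext A
  simp

theorem hasFDerivWithinAt_logPotential {b : Fin J → ℝ} (hb : NondegenerateWeights b)
    {Ω : Set (Fin J → ℂ)} {ζ : (Fin J → ℂ) → Fin J → ℂ} (h0 : 0 ∈ Ω)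
    (hζ : ∀ A ∈ Ω, coeffMap b (ζ A) = A) {z : ℂ} (hz : z ≠ 0) :
    HasFDerivWithinAt (fun A => logPotential b (ζ A) z)
      (Complex.reCLM.comp ((∑ ℓ : Fin J, z⁻¹ ^ ((ℓ : ℕ) + 1) •
        ContinuousLinearMap.proj (R := ℂ) (φ := fun _ : Fin J => ℂ) ℓ).restrictScalars ℝ)) Ω 0 := by
  set R : (Fin J → ℂ) → ℝ := fun A =>
    logPotential b (ζ A) z - truncatedPotential b z (newtonInv A) with hR
  have hO : R =O[𝓝[Ω] 0] fun A => ‖ζ A‖ ^ (J + 1) := by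
    refine IsBigO.of_bound ((∑ j, |b j|) * 2 * ‖z⁻¹‖ ^ (J + 1)) ?_
    have hsmall : Tendsto (fun A => ‖ζ A‖ * ‖z⁻¹‖) (𝓝[Ω] 0) (𝓝 0) := by
      simpa using (tendsto_rightInverse hb hζ).norm.mul_const ‖z⁻¹‖
    filter_upwards [self_mem_nhdsWithin, hsmall.eventually (ge_mem_nhds one_half_pos)] with A hA hs
    rw [Real.norm_of_nonneg (by positivity : 0 ≤ ‖ζ A‖ ^ (J + 1))]
    have := norm_logPotential_sub_le b hz hs
    rwa [(coeffMap_eq_iff b (ζ A) A).1 (hζ A hA)] at this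
  have ho : R =o[𝓝[Ω] 0] fun A => A := hO.trans_isLittleO (norm_pow_isLittleO hb hζ)
  -- The asymptotic bound also holds at the point `0 ∈ Ω` itself, where its right side is 0.
  have hR0 : R 0 = 0 := by
    obtain ⟨C, hC⟩ := ho.isBigO.bound
    simpa using hC.self_of_nhdsWithin h0
  have hRd : HasFDerivWithinAt R (0 : (Fin J → ℂ) →L[ℝ] ℝ) Ω 0 := by
    refine HasFDerivWithinAt.of_isLittleO ?_
    simpa [hR0] using ho
  have := hRd.add (hasFDerivAt_truncatedPotential b z).hasFDerivWithinAt
  rw [zero_add] at this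
  convert! this using 1
  funext A
  simp [hR]

theorem inv_polar_pow (r θ : ℝ) (n : ℕ) :
    ((r : ℂ) * Complex.exp (θ * Complex.I))⁻¹ ^ n =
      ((r ^ n)⁻¹ : ℝ) * Complex.exp ((-(n * θ) : ℝ) * Complex.I) := by
  rw [mul_inv, mul_pow, ← Complex.exp_neg, ← Complex.exp_nat_mul]
  push_cast
  rw [inv_pow]
  congr 2
  ring

end Potential

end WeightedCluster

end

/-! ### The main theorem -/

theorem propositionp (J : ℕ) (b : Fin J → ℝ)
    (hsum : ∑ j, b j = (J : ℝ))
    (hb : b ∉ WeightedCluster.degenerateWeights J) :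
    -- the weighted discriminant locus is a proper algebraic subvariety
    (∃ I : Ideal (MvPolynomial (Fin J) ℂ), I ≠ ⊥ ∧
      WeightedCluster.discriminantLocus b = MvPolynomial.zeroLocus ℂ I) ∧
    -- the map is proper and holomorphic
    Differentiable ℂ (WeightedCluster.coeffMap b) ∧
    IsProperMap (WeightedCluster.coeffMap b) ∧
    -- i) it is ramified exactly along the partial diagonals, with the stated branch locus
    WeightedCluster.ramificationLocus (WeightedCluster.coeffMap b) =
      WeightedCluster.partialDiagonals J ∧
    WeightedCluster.coeffMap b ''
        WeightedCluster.ramificationLocus (WeightedCluster.coeffMap b) =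
      WeightedCluster.discriminantLocus b ∧
    -- ii) it is a covering with `J!` sheets over the complement of the discriminant locus,
    -- and the covering space consists of tuples of distinct points
    WeightedCluster.coeffMap b ⁻¹' (WeightedCluster.discriminantLocus b)ᶜ ⊆
      {Z | Function.Injective Z} ∧
    IsCoveringMap
      ((WeightedCluster.discriminantLocus b)ᶜ.restrictPreimage (WeightedCluster.coeffMap b)) ∧
    (∀ A ∉ WeightedCluster.discriminantLocus b,
      (WeightedCluster.coeffMap b ⁻¹' {A}).ncard = J.factorial) ∧
    -- iii) for every right inverse `ζ` on a set `Ω` containing `0` (a full neighbourhood, or the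
    -- domain of a branch together with `0`), the function `v` is differentiable at `0`, and its
    -- differential has the stated components in the coordinates `A_ℓ = e'_ℓ + i e''_ℓ`
    (∀ (Ω : Set (Fin J → ℂ)) (ζ : (Fin J → ℂ) → (Fin J → ℂ)), 0 ∈ Ω →
      (∀ A ∈ Ω, WeightedCluster.coeffMap b (ζ A) = A) →
      ∀ (r θ : ℝ), 0 < r →
        ∃ L : (Fin J → ℂ) →L[ℝ] ℝ,
          HasFDerivWithinAt
            (fun A => WeightedCluster.logPotential b (ζ A)
              ((r : ℂ) * Complex.exp ((θ : ℂ) * Complex.I))) L Ω 0 ∧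
          ∀ ℓ : Fin J,
            L (Pi.single ℓ 1) =
              Real.cos ((((ℓ : ℕ) + 1 : ℕ) : ℝ) * θ) * (r ^ ((ℓ : ℕ) + 1))⁻¹ ∧
            L (Pi.single ℓ Complex.I) =
              Real.sin ((((ℓ : ℕ) + 1 : ℕ) : ℝ) * θ) * (r ^ ((ℓ : ℕ) + 1))⁻¹) := by
  have hnd := WeightedCluster.nondegenerateWeights_of_notMem hb
  have hram := WeightedCluster.ramificationLocus_coeffMap hnd.ne_zero
  have hinj : WeightedCluster.coeffMap b ⁻¹' (WeightedCluster.discriminantLocus b)ᶜ ⊆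
      {Z | Function.Injective Z} := fun Z hZ =>
    WeightedCluster.injective_of_notMem_partialDiagonals fun hd => hZ ⟨Z, hd, rfl⟩
  have hprop := WeightedCluster.isProperMap_coeffMap hnd
  refine ⟨WeightedCluster.exists_ideal_discriminantLocus_eq hnd,
    (WeightedCluster.contDiff_coeffMap b).differentiable one_ne_zero, hprop, hram,
    by rw [hram]; rfl, hinj, ?_, ?_, ?_⟩
  · refine (hprop.isCoveringMapOn ?_).isCoveringMap_restrictPreimage
    intro Z hZ
    obtain ⟨e, he, heq⟩ := WeightedCluster.exists_openPartialHomeomorph_of_injective (𝕜 := ℂ)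
      (WeightedCluster.contDiff_coeffMap b)
      (WeightedCluster.injective_fderiv_coeffMap hnd.ne_zero (hinj hZ))
    exact ⟨e, he, heq.symm⟩
  · intro A hA
    rw [← WeightedCluster.ncard_powerSumMap
      (hnd.map Complex.ofRealHom Complex.ofReal_injective)
      (a := WeightedCluster.newtonInv A) fun Z hZ h =>
        hA ⟨Z, hZ, (WeightedCluster.coeffMap_eq_iff b Z A).2 h⟩]
    congr 1
    ext Z
    exact WeightedCluster.coeffMap_eq_iff b Z A
  · intro Ω ζ h0 hζ r θ hr
    have hz : (r : ℂ) * Complex.exp ((θ : ℂ) * Complex.I) ≠ 0 :=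
      mul_ne_zero (by exact_mod_cast hr.ne') (Complex.exp_ne_zero _)
    refine ⟨_, WeightedCluster.hasFDerivWithinAt_logPotential hnd h0 hζ hz, fun ℓ => ?_⟩
    have happly : ∀ c : ℂ, (Complex.reCLM.comp ((∑ k : Fin J,
        ((r : ℂ) * Complex.exp ((θ : ℂ) * Complex.I))⁻¹ ^ ((k : ℕ) + 1) •
          ContinuousLinearMap.proj (R := ℂ) (φ := fun _ : Fin J => ℂ) k).restrictScalars ℝ))
        (Pi.single ℓ c) =
        (((r : ℂ) * Complex.exp ((θ : ℂ) * Complex.I))⁻¹ ^ ((ℓ : ℕ) + 1) * c).re := by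
      intro c
      simp [Pi.single_apply]
    -- The components are the real parts of `z ^ (-(ℓ + 1))` and of `i` times it; the latter is
    -- minus the imaginary part, which turns `-sin` into `sin`.
    rw [happly, happly, WeightedCluster.inv_polar_pow]
    constructor
    · rw [mul_one, Complex.re_ofReal_mul, Complex.exp_ofReal_mul_I_re, Real.cos_neg, mul_comm]
    · rw [Complex.mul_I_re, Complex.im_ofReal_mul, Complex.exp_ofReal_mul_I_im, Real.sin_neg]
      ring
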